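/- Let $\Omega=(0,\pi)^2$ and let $L$ be the self-adjoint Neumann Laplacian in $L^2(\Omega)$ (real-valued functions), with eigenvalues $0=\lambda_1<\lambda_2\le\lambda_3\le\cdots$ counted with multiplicity. Let \[ \mathcal H^{\mathrm{ARot}}=\{\psi : \psi(\pi-x,\pi-y)=-\psi(x,y)\},\qquad \mathcal H^{\mathrm{SRot}}=\{\psi : \psi(\pi-x,\pi-y)=\psi(x,y)\}, \] \[ \mathcal H^{\mathrm{AMir}}=\{\psi : \psi(\pi-x,y)=-\psi(x,y),\ \psi(x,\pi-y)=-\psi(x,y)\}, \] and for each of these subspaces $\mathcal H^{\bullet}$ of $L^2(\Omega)$ let $\lambda_1^{\bullet}\le\lambda_2^{\bullet}\le\cdots$ be the eigenvalues, counted with multiplicity, of the restriction of $L$ to $\mathcal H^{\bullet}$. For a (continuous) eigenfunction $\Psi$ of $L$, let $\mu(\Psi)$ be the number of its nodal domains, i.e. of connected components of $\{z\in\Omega : \Psi(z)\neq 0\}$. Let $n\ge 1$ and let $\Psi_n\neq 0$ be an eigenfunction of $L$ with eigenvalue $\lambda_n$. Then $\mu(\Psi_n)$ is finite, and: 1. If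 $\lambda_n$ is an odd integer, then $\mu(\Psi_n)$ is even, and $\mu(\Psi_n)\le 2m$ for every $m\ge1$ with $\lambda_n=\lambda_m^{\mathrm{ARot}}$. 2. If $\lambda_n$ is an even integer, then $\mu(\Psi_n)\le 2m$ for every $m\ge1$ with $\lambda_n=\lambda_m^{\mathrm{SRot}}$. 3. If $\lambda_n$ is an even integer and $\Psi_n\in\mathcal H^{\mathrm{AMir}}$, then $\mu(\Psi_n)$ is divisible by $4$, and $\mu(\Psi_n)\le 4m$ for every $m\ge1$ with $\lambda_n=\lambda_m^{\mathrm{AMir}}$. -/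

import Mathlib

open Set MeasureTheory
open scoped ContDiff

noncomputable section

namespace NeumannSquare

/-- The open square `Ω = (0, π) × (0, π)`. -/
def square : Set (ℝ × ℝ) := Ioo 0 Real.pi ×ˢ Ioo 0 Real.pi

/-- The real Hilbert space `L²(Ω)`. -/
abbrev L2 : Type := Lp ℝ 2 (volume.restrict square)

/-- `g ∈ L²(Ω)` is the weak derivative of `u ∈ L²(Ω)` in the direction `e`, tested against
`C_c^∞(Ω)`. -/
def IsWeakDeriv (e : ℝ × ℝ) (u g : L2) : Prop :=
  ∀ φ : ℝ × ℝ → ℝ, ContDiff ℝ ∞ φ → HasCompactSupport φ → tsupport φ ⊆ square →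
    ∫ z in square, u z * fderiv ℝ φ z e = -∫ z in square, g z * φ z

/-- `u ∈ H¹(Ω)` with weak gradient `(g₁, g₂)`. -/
def IsWeakGrad (u g₁ g₂ : L2) : Prop :=
  IsWeakDeriv (1, 0) u g₁ ∧ IsWeakDeriv (0, 1) u g₂

/-- The graph of the self-adjoint Neumann Laplacian `L` in `L²(Ω)`, that is, of the operator
associated with the form `(u, v) ↦ ∫_Ω ∇u · ∇v` on `H¹(Ω)`: `u` lies in the domain and `L u = f`
if and only if `u ∈ H¹(Ω)` and `∫_Ω ∇u · ∇v = ∫_Ω f v` for all `v ∈ H¹(Ω)`. -/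
def IsNeumannLaplacian (u f : L2) : Prop :=
  ∃ g₁ g₂ : L2, IsWeakGrad u g₁ g₂ ∧
    ∀ v h₁ h₂ : L2, IsWeakGrad v h₁ h₂ →
      inner ℝ g₁ h₁ + inner ℝ g₂ h₂ = inner ℝ f v

/-- `ψ(π - x, π - y) = -ψ(x, y)` on the square. -/
def ARot : Set (ℝ × ℝ → ℝ) :=
  {ψ | ∀ᵐ z ∂volume.restrict square, ψ (Real.pi - z.1, Real.pi - z.2) = -ψ z}

/-- `ψ(π - x, π - y) = ψ(x, y)` on the square. -/
def SRot : Set (ℝ × ℝ → ℝ) :=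
  {ψ | ∀ᵐ z ∂volume.restrict square, ψ (Real.pi - z.1, Real.pi - z.2) = ψ z}

/-- `ψ(π - x, y) = -ψ(x, y)` and `ψ(x, π - y) = -ψ(x, y)` on the square. -/
def AMir : Set (ℝ × ℝ → ℝ) :=
  {ψ | ∀ᵐ z ∂volume.restrict square,
    ψ (Real.pi - z.1, z.2) = -ψ z ∧ ψ (z.1, Real.pi - z.2) = -ψ z}

/-- The `n`-th eigenvalue (`n ≥ 1`, increasing order, counted with multiplicity) of the Neumann
Laplacian restricted to the subspace `H` of `L²(Ω)`: the least `t` such that there are `n` linearly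
independent eigenfunctions in `H` with eigenvalues at most `t`. -/
def eigenvalueOn (H : Set (ℝ × ℝ → ℝ)) (n : ℕ) : ℝ :=
  sInf {t : ℝ | ∃ v : Fin n → L2, LinearIndependent ℝ v ∧
    ∀ i, (v i : ℝ × ℝ → ℝ) ∈ H ∧ ∃ s : ℝ, s ≤ t ∧ IsNeumannLaplacian (v i) (s • v i)}

/-- The `n`-th eigenvalue `λ_n` of the Neumann Laplacian `L` on the square, `n ≥ 1`. -/
def eigenvalue (n : ℕ) : ℝ := eigenvalueOn univ n

/-- `Ψ` is an eigenfunction of `L` with eigenvalue `t`, taken in its continuous version, so that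
its nodal domains make sense. -/
def IsEigenpair (t : ℝ) (Ψ : ℝ × ℝ → ℝ) : Prop :=
  ContinuousOn Ψ square ∧
    ∃ u : L2, u ≠ 0 ∧ Ψ =ᵐ[volume.restrict square] u ∧ IsNeumannLaplacian u (t • u)

/-- The nodal domains of `Ψ`: the connected components of `Ω \ Ψ⁻¹(0)`. -/
def nodalDomains (Ψ : ℝ × ℝ → ℝ) : Set (Set (ℝ × ℝ)) :=
  connectedComponentIn {z ∈ square | Ψ z ≠ 0} '' {z ∈ square | Ψ z ≠ 0}

/-- The number `μ(Ψ)` of nodal domains, meaningful when `nodalDomains Ψ` is finite. -/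
def nodalCount (Ψ : ℝ × ℝ → ℝ) : ℕ := (nodalDomains Ψ).ncard

end NeumannSquare

end

noncomputable section

namespace NeumannSquare

open Filter Topology

/-! The products `cos (p x) cos (q y)` form a complete orthogonal system of Neumann eigenfunctions
with eigenvalues `p² + q²`, so an eigenfunction for `λ` is a finite, hence analytic, combination of
those with `p² + q² = λ`. The half-turn multiplies such a mode by `(-1)^(p + q)`, and `p² + q²` has
the parity of `p + q`. Hence every eigenfunction is odd under the half-turn if `λ` is odd and even
under it if `λ` is even.

The symmetries permute the nodal domains, and Courant's argument is run with one coefficient per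
orbit (`card_label_le`, `card_orbits_le`). Let `N` be the number of modes of the symmetry class
strictly below `λ`. With more than `N + 1` orbits, some nonzero choice of coefficients gives a
function `w`, a multiple of the eigenfunction on each domain, that is orthogonal to these `N` modes
and vanishes on one chosen orbit. By symmetry `w` is orthogonal to all modes outside the class. Its
energy is `λ` times its mass (`energy_nodalSum`), so only modes of eigenvalue exactly `λ` survive
(`IsWeakGrad.inner_cosMode_eq_zero`). Thus `w` is analytic, zero on an open set, and so zero
everywhere: a contradiction. If `λ` is the `m`-th eigenvalue of the class then `N < m`
(`ncard_modes_lt`), so there are at most `m` orbits.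

It remains to find the size of the orbits. A symmetry that reverses the sign of the eigenfunction
fixes no nodal domain, so half-turn orbits have two elements in the odd case and at most two
otherwise. Under both mirror antisymmetries the half-turn preserves the sign, but a domain invariant
under it would cross the line `x = π/2`, where the eigenfunction vanishes. All orbits of the
four-element group then have four elements. -/

/-- Lebesgue measure on the square. -/
abbrev squareMeasure : Measure (ℝ × ℝ) := volume.restrict square

/-! ### The square and pairings with continuous functions -/

lemma isOpen_square : IsOpen square := isOpen_Ioo.prod isOpen_Ioo

lemma measurableSet_square : MeasurableSet square := isOpen_square.measurableSet

lemma convex_square : Convex ℝ square := (convex_Ioo _ _).prod (convex_Ioo _ _)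

lemma square_subset_closed : square ⊆ Icc 0 Real.pi ×ˢ Icc 0 Real.pi :=
  prod_mono Ioo_subset_Icc_self Ioo_subset_Icc_self

lemma isCompact_closedSquare : IsCompact (Icc 0 Real.pi ×ˢ Icc 0 Real.pi : Set (ℝ × ℝ)) :=
  isCompact_Icc.prod isCompact_Icc

instance isFiniteMeasure_squareMeasure : IsFiniteMeasure squareMeasure :=
  ⟨by
    rw [Measure.restrict_apply_univ]
    exact (measure_mono square_subset_closed).trans_lt isCompact_closedSquare.measure_lt_top⟩

lemma exists_bound_on_square {f : ℝ × ℝ → ℝ} (hf : Continuous f) :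
    ∃ C, ∀ z ∈ square, |f z| ≤ C := by
  obtain ⟨C, hC⟩ := isCompact_closedSquare.exists_bound_of_continuousOn hf.continuousOn
  exact ⟨C, fun z hz => hC z (square_subset_closed hz)⟩

lemma memLp_of_continuous {f : ℝ × ℝ → ℝ} (hf : Continuous f) : MemLp f 2 squareMeasure := by
  obtain ⟨C, hC⟩ := exists_bound_on_square hf
  exact MemLp.of_bound hf.aestronglyMeasurable C
    ((ae_restrict_iff' measurableSet_square).2 (Filter.Eventually.of_forall hC))

/-- The element of `L²` given by a continuous function. -/
def ofContinuous (f : ℝ × ℝ → ℝ) (hf : Continuous f) : L2 := (memLp_of_continuous hf).toLp f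

lemma coeFn_ofContinuous {f : ℝ × ℝ → ℝ} (hf : Continuous f) :
    (ofContinuous f hf : ℝ × ℝ → ℝ) =ᵐ[squareMeasure] f := MemLp.coeFn_toLp _

lemma integrable_mul_continuous (u : L2) {f : ℝ × ℝ → ℝ} (hf : Continuous f) :
    Integrable (fun z => u z * f z) squareMeasure :=
  (Lp.memLp u).integrable_mul (memLp_of_continuous hf)

lemma integrable_coe (u : L2) : Integrable (u : ℝ × ℝ → ℝ) squareMeasure := by
  simpa using integrable_mul_continuous u (continuous_const (y := (1 : ℝ)))

lemma inner_eq_integral (u v : L2) : inner ℝ u v = ∫ z in square, u z * v z := by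
  rw [L2.inner_def]
  exact integral_congr_ae (Filter.Eventually.of_forall fun z => by simp [mul_comm])

lemma inner_toLp_right (u : L2) {f : ℝ × ℝ → ℝ} (hf : MemLp f 2 squareMeasure) :
    inner ℝ u (hf.toLp f) = ∫ z in square, u z * f z := by
  rw [inner_eq_integral]
  refine integral_congr_ae ?_
  filter_upwards [hf.coeFn_toLp] with z hz
  rw [hz]

lemma inner_toLp_toLp {f g : ℝ × ℝ → ℝ} (hf : MemLp f 2 squareMeasure)
    (hg : MemLp g 2 squareMeasure) :
    inner ℝ (hf.toLp f) (hg.toLp g) = ∫ z in square, f z * g z := by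
  rw [inner_toLp_right]
  refine integral_congr_ae ?_
  filter_upwards [hf.coeFn_toLp] with z hz
  rw [hz]

lemma inner_ofContinuous_right (u : L2) {f : ℝ × ℝ → ℝ} (hf : Continuous f) :
    inner ℝ u (ofContinuous f hf) = ∫ z in square, u z * f z := inner_toLp_right _ _

/-! ### Weak derivatives and symmetry of the Neumann form -/

lemma continuous_fderiv_dir {φ : ℝ × ℝ → ℝ} (hφ : ContDiff ℝ ∞ φ) (e : ℝ × ℝ) :
    Continuous fun z => fderiv ℝ φ z e :=
  (hφ.continuous_fderiv (by simp)).clm_apply continuous_const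

/-- With both sides written as inner products, closure under linear operations follows from
bilinearity, with no integrability side goals. -/
lemma isWeakDeriv_iff {e : ℝ × ℝ} {u g : L2} :
    IsWeakDeriv e u g ↔ ∀ (φ : ℝ × ℝ → ℝ) (hφ : ContDiff ℝ ∞ φ), HasCompactSupport φ →
      tsupport φ ⊆ square →
      inner ℝ u (ofContinuous (fun z => fderiv ℝ φ z e) (continuous_fderiv_dir hφ e)) =
        -inner ℝ g (ofContinuous φ hφ.continuous) := by
  simp only [inner_ofContinuous_right]
  rfl

lemma IsWeakDeriv.add {e : ℝ × ℝ} {u v g h : L2} (hu : IsWeakDeriv e u g)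
    (hv : IsWeakDeriv e v h) : IsWeakDeriv e (u + v) (g + h) := by
  rw [isWeakDeriv_iff] at *
  intro φ h1 h2 h3
  rw [inner_add_left, inner_add_left, hu φ h1 h2 h3, hv φ h1 h2 h3]
  ring

lemma IsWeakDeriv.smul {e : ℝ × ℝ} {u g : L2} (hu : IsWeakDeriv e u g) (c : ℝ) :
    IsWeakDeriv e (c • u) (c • g) := by
  rw [isWeakDeriv_iff] at *
  intro φ h1 h2 h3
  rw [real_inner_smul_left, real_inner_smul_left, hu φ h1 h2 h3]
  ring

lemma IsWeakDeriv.zero {e : ℝ × ℝ} : IsWeakDeriv e 0 0 := by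
  rw [isWeakDeriv_iff]
  intro φ h1 h2 h3
  simp

lemma IsWeakGrad.add {u v g₁ g₂ h₁ h₂ : L2} (hu : IsWeakGrad u g₁ g₂) (hv : IsWeakGrad v h₁ h₂) :
    IsWeakGrad (u + v) (g₁ + h₁) (g₂ + h₂) := ⟨hu.1.add hv.1, hu.2.add hv.2⟩

lemma IsWeakGrad.smul {u g₁ g₂ : L2} (hu : IsWeakGrad u g₁ g₂) (c : ℝ) :
    IsWeakGrad (c • u) (c • g₁) (c • g₂) := ⟨hu.1.smul c, hu.2.smul c⟩

lemma IsWeakGrad.zero : IsWeakGrad 0 0 0 := ⟨.zero, .zero⟩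

lemma IsWeakGrad.sum {ι : Type*} (s : Finset ι) {u g₁ g₂ : ι → L2}
    (h : ∀ i ∈ s, IsWeakGrad (u i) (g₁ i) (g₂ i)) :
    IsWeakGrad (∑ i ∈ s, u i) (∑ i ∈ s, g₁ i) (∑ i ∈ s, g₂ i) := by
  classical
  induction s using Finset.induction_on with
  | empty => simpa using IsWeakGrad.zero
  | insert a s ha ih =>
    simp only [Finset.sum_insert ha]
    exact (h a (by simp)).add (ih fun i hi => h i (by simp [hi]))

/-- Test functions are dense in `L²`. -/
lemma eq_zero_of_inner_test_eq_zero {u : L2}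
    (h : ∀ φ : ℝ × ℝ → ℝ, ContDiff ℝ ∞ φ → HasCompactSupport φ → tsupport φ ⊆ square →
      ∫ z in square, u z * φ z = 0) : u = 0 := by
  have hloc : LocallyIntegrableOn (u : ℝ × ℝ → ℝ) square volume :=
    IntegrableOn.locallyIntegrableOn (integrable_coe u)
  have key := isOpen_square.ae_eq_zero_of_integral_contDiff_smul_eq_zero hloc
    (fun φ h1 h2 h3 => by
      rw [← h φ h1 h2 h3, ← setIntegral_eq_integral_of_forall_compl_eq_zero (s := square)]
      · exact integral_congr_ae (Filter.Eventually.of_forall fun z => by simp [mul_comm])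
      · intro z hz
        rw [image_eq_zero_of_notMem_tsupport fun hz' => hz (h3 hz'), zero_smul])
  refine (Lp.eq_zero_iff_ae_eq_zero).2 ?_
  rw [Filter.EventuallyEq, ae_restrict_iff' measurableSet_square]
  exact key

/-- The operator's definition hides the weak gradient behind an existential; uniqueness identifies
it with a gradient computed by hand. -/
lemma IsWeakDeriv.unique {e : ℝ × ℝ} {u g h : L2} (hg : IsWeakDeriv e u g)
    (hh : IsWeakDeriv e u h) : g = h := by
  rw [← sub_eq_zero]
  refine eq_zero_of_inner_test_eq_zero fun φ h1 h2 h3 => ?_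
  rw [isWeakDeriv_iff] at hg hh
  have := hg φ h1 h2 h3
  have h' := hh φ h1 h2 h3
  rw [← inner_ofContinuous_right _ h1.continuous, inner_sub_left]
  linarith

lemma IsWeakGrad.unique {u g₁ g₂ h₁ h₂ : L2} (hg : IsWeakGrad u g₁ g₂)
    (hh : IsWeakGrad u h₁ h₂) : g₁ = h₁ ∧ g₂ = h₂ := ⟨hg.1.unique hh.1, hg.2.unique hh.2⟩

/-- The weak Neumann problem is symmetric. -/
lemma IsNeumannLaplacian.inner_comm {u f v h : L2} (hu : IsNeumannLaplacian u f)
    (hv : IsNeumannLaplacian v h) : inner ℝ f v = inner ℝ h u := by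
  obtain ⟨g₁, g₂, hg, H⟩ := hu
  obtain ⟨k₁, k₂, hk, K⟩ := hv
  rw [← H v k₁ k₂ hk, ← K u g₁ g₂ hg, real_inner_comm, real_inner_comm k₂]

lemma IsNeumannLaplacian.inner_eq_zero {u v : L2} {s t : ℝ} (hu : IsNeumannLaplacian u (s • u))
    (hv : IsNeumannLaplacian v (t • v)) (hst : s ≠ t) : inner ℝ u v = 0 := by
  have := hu.inner_comm hv
  rw [real_inner_smul_left, real_inner_smul_left, real_inner_comm] at this
  have h : (s - t) * inner ℝ v u = 0 := by linarith
  rw [real_inner_comm]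
  exact (mul_eq_zero.1 h).resolve_left (sub_ne_zero.2 hst)

/-- Testing the weak equation with `u` itself gives `‖∇u‖² = s ‖u‖²`. This bounds from below the set
whose infimum defines an eigenvalue. -/
lemma IsNeumannLaplacian.nonneg {u : L2} {s : ℝ} (hu : IsNeumannLaplacian u (s • u))
    (h0 : u ≠ 0) : 0 ≤ s := by
  obtain ⟨g₁, g₂, hg, H⟩ := hu
  have := H u g₁ g₂ hg
  rw [real_inner_smul_left, real_inner_self_eq_norm_sq, real_inner_self_eq_norm_sq,
    real_inner_self_eq_norm_sq] at this
  by_contra! hs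
  have h1 : 0 < ‖u‖ ^ 2 := by positivity
  nlinarith [sq_nonneg ‖g₁‖, sq_nonneg ‖g₂‖]

/-! ### Cutoffs and testing against products that do not vanish on the whole boundary -/

/-- Smooth cutoff functions on `(0, π)`, increasing to `1`. -/
def cutoff (n : ℕ) (x : ℝ) : ℝ := Real.smoothTransition (n * (x * (Real.pi - x)) - 1)

lemma contDiff_cutoff (n : ℕ) : ContDiff ℝ ∞ (cutoff n) :=
  Real.smoothTransition.contDiff.comp (by fun_prop)

lemma cutoff_nonneg (n : ℕ) (x : ℝ) : 0 ≤ cutoff n x := Real.smoothTransition.nonneg _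

lemma cutoff_le_one (n : ℕ) (x : ℝ) : cutoff n x ≤ 1 := Real.smoothTransition.le_one _

lemma one_le_of_cutoff_ne_zero {n : ℕ} {x : ℝ} (h : cutoff n x ≠ 0) :
    1 ≤ n * (x * (Real.pi - x)) := by
  by_contra! h'
  exact h (Real.smoothTransition.zero_of_nonpos (by linarith))

lemma mem_Ioo_of_one_le {n : ℕ} {x : ℝ} (h : 1 ≤ n * (x * (Real.pi - x))) :
    x ∈ Ioo 0 Real.pi := by
  have h1 : 0 < x * (Real.pi - x) := by
    by_contra! h'
    have := mul_nonpos_of_nonneg_of_nonpos n.cast_nonneg h'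
    linarith
  rcases mul_pos_iff.1 h1 with h2 | h2
  · exact ⟨h2.1, by linarith⟩
  · exfalso; linarith [Real.pi_pos]

lemma eventually_cutoff_eq_one {x : ℝ} (hx : x ∈ Ioo 0 Real.pi) :
    ∀ᶠ n in atTop, cutoff n =ᶠ[𝓝 x] fun _ => 1 := by
  have hq : 0 < x * (Real.pi - x) := mul_pos hx.1 (by linarith [hx.2])
  obtain ⟨N, hN⟩ := exists_nat_gt (2 / (x * (Real.pi - x)))
  filter_upwards [eventually_ge_atTop N] with n hn
  have h2 : 2 < n * (x * (Real.pi - x)) := by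
    rw [div_lt_iff₀ hq] at hN
    exact hN.trans_le (by gcongr)
  have hc : Continuous fun y : ℝ => (n : ℝ) * (y * (Real.pi - y)) := by fun_prop
  filter_upwards [hc.continuousAt.eventually (lt_mem_nhds h2)] with y hy
  exact Real.smoothTransition.one_of_one_le (by linarith)

/-- The derivative is of size `n`, but it lives only where `n x (π - x)` is between 1 and 2; the
weight `x (π - x)` therefore cancels the growth in `n`. -/
lemma exists_bound_deriv_cutoff :
    ∃ C, ∀ (n : ℕ), ∀ x ∈ Ioo 0 Real.pi, |deriv (cutoff n) x| * (x * (Real.pi - x)) ≤ C := by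
  have hσ : ContDiff ℝ ∞ Real.smoothTransition := Real.smoothTransition.contDiff
  have hσ' : Continuous (deriv Real.smoothTransition) := hσ.continuous_deriv (by simp)
  obtain ⟨M, hM⟩ := (isCompact_Icc (a := (-1 : ℝ)) (b := 2)).exists_bound_of_continuousOn
    hσ'.continuousOn
  have hM0 : 0 ≤ M := (norm_nonneg _).trans (hM 0 (by norm_num))
  -- Here `s + 1` stands for `n x (π - x)`. Above `s = 2` the transition is constant, so only the
  -- compact interval `[-1, 2]` matters.
  have hb : ∀ s : ℝ, -1 ≤ s → |deriv Real.smoothTransition s| * (s + 1) ≤ 3 * M := by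
    intro s hs
    rcases le_or_gt s 2 with h | h
    · have := hM s ⟨hs, h⟩
      rw [Real.norm_eq_abs] at this
      nlinarith [abs_nonneg (deriv Real.smoothTransition s)]
    · have : Real.smoothTransition =ᶠ[𝓝 s] fun _ => 1 := by
        filter_upwards [lt_mem_nhds h] with y hy
        exact Real.smoothTransition.one_of_one_le (by linarith)
      rw [this.deriv_eq]
      simp [hM0]
  refine ⟨3 * M * Real.pi, fun n x hx => ?_⟩
  have hq : 0 < x * (Real.pi - x) := mul_pos hx.1 (by linarith [hx.2])
  have hd : HasDerivAt (cutoff n)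
      (deriv Real.smoothTransition (n * (x * (Real.pi - x)) - 1) * (n * (Real.pi - 2 * x))) x := by
    refine HasDerivAt.comp x ((hσ.differentiable (by simp)) _).hasDerivAt ?_
    have : HasDerivAt (fun y : ℝ => (n : ℝ) * (y * (Real.pi - y)) - 1)
        (n * (1 * (Real.pi - x) + x * -1)) x :=
      ((((hasDerivAt_id' x).mul ((hasDerivAt_id' x).const_sub Real.pi)).const_mul
        (n : ℝ)).sub_const 1)
    exact this.congr_deriv (by ring)
  have h2 : |Real.pi - 2 * x| ≤ Real.pi := by
    rw [abs_le]; constructor <;> linarith [hx.1, hx.2]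
  have hs := hb (n * (x * (Real.pi - x)) - 1) (by nlinarith [(Nat.cast_nonneg n : (0 : ℝ) ≤ n)])
  rw [hd.deriv, abs_mul, abs_mul, Nat.abs_cast]
  calc _ = (|deriv Real.smoothTransition (n * (x * (Real.pi - x)) - 1)| *
        (n * (x * (Real.pi - x)) - 1 + 1)) * |Real.pi - 2 * x| := by ring
    _ ≤ _ := by gcongr

lemma contDiff_cutoff_mul {a : ℝ → ℝ} (ha : ContDiff ℝ ∞ a) (n : ℕ) :
    ContDiff ℝ ∞ fun x => cutoff n x * a x := (contDiff_cutoff n).mul ha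

lemma tendsto_cutoff_mul (a : ℝ → ℝ) {x : ℝ} (hx : x ∈ Ioo 0 Real.pi) :
    Tendsto (fun n => cutoff n x * a x) atTop (𝓝 (a x)) := by
  refine tendsto_const_nhds.congr' ?_
  filter_upwards [eventually_cutoff_eq_one hx] with n hn
  rw [hn.eq_of_nhds, one_mul]

lemma tendsto_deriv_cutoff_mul (a : ℝ → ℝ) {x : ℝ} (hx : x ∈ Ioo 0 Real.pi) :
    Tendsto (fun n => deriv (fun x => cutoff n x * a x) x) atTop (𝓝 (deriv a x)) := by
  refine tendsto_const_nhds.congr' ?_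
  filter_upwards [eventually_cutoff_eq_one hx] with n hn
  refine EventuallyEq.deriv_eq ?_
  filter_upwards [hn] with y hy
  rw [hy, one_mul]

lemma exists_bound_cutoff_mul {a : ℝ → ℝ} (ha : ContDiff ℝ ∞ a) :
    ∃ C, ∀ (n : ℕ), ∀ x ∈ Ioo 0 Real.pi, |cutoff n x * a x| ≤ C := by
  obtain ⟨C, hC⟩ := (isCompact_Icc (a := (0 : ℝ)) (b := Real.pi)).exists_bound_of_continuousOn
    ha.continuous.continuousOn
  refine ⟨C, fun n x hx => ?_⟩
  rw [abs_mul, abs_of_nonneg (cutoff_nonneg n x)]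
  exact (mul_le_of_le_one_left (abs_nonneg _) (cutoff_le_one n x)).trans
    (hC x (Ioo_subset_Icc_self hx))

/-- By the product rule the only dangerous term is `cutoff' * a`, and the decay of `a` at both
endpoints offsets the blow-up of `cutoff'`. -/
lemma exists_bound_deriv_cutoff_mul {a : ℝ → ℝ} (ha : ContDiff ℝ ∞ a) {K : ℝ}
    (hK : ∀ x ∈ Ioo 0 Real.pi, |a x| ≤ K * (x * (Real.pi - x))) :
    ∃ C, ∀ (n : ℕ), ∀ x ∈ Ioo 0 Real.pi, |deriv (fun x => cutoff n x * a x) x| ≤ C := by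
  obtain ⟨C, hC⟩ := (isCompact_Icc (a := (0 : ℝ)) (b := Real.pi)).exists_bound_of_continuousOn
    (ha.continuous_deriv (by simp)).continuousOn
  obtain ⟨D, hD⟩ := exists_bound_deriv_cutoff
  refine ⟨|K| * D + C, fun n x hx => ?_⟩
  have hq : 0 < x * (Real.pi - x) := mul_pos hx.1 (by linarith [hx.2])
  have hd := (((contDiff_cutoff n).differentiable (by simp)) x).hasDerivAt.mul
    ((ha.differentiable (by simp)) x).hasDerivAt
  have hd' : deriv (fun x => cutoff n x * a x) x = _ := hd.deriv
  rw [hd']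
  refine (abs_add_le _ _).trans (add_le_add ?_ ?_)
  · rw [abs_mul]
    calc _ ≤ |deriv (cutoff n) x| * (|K| * (x * (Real.pi - x))) := by
          gcongr
          exact (hK x hx).trans (by gcongr; exact le_abs_self K)
      _ = |K| * (|deriv (cutoff n) x| * (x * (Real.pi - x))) := by ring
      _ ≤ _ := by gcongr; exact hD n x hx
  · rw [abs_mul, abs_of_nonneg (cutoff_nonneg n x)]
    exact (mul_le_of_le_one_left (abs_nonneg _) (cutoff_le_one n x)).trans
      (hC x (Ioo_subset_Icc_self hx))

lemma fderiv_mul_fst {a b : ℝ → ℝ} (ha : ContDiff ℝ ∞ a) (hb : ContDiff ℝ ∞ b) (z : ℝ × ℝ) :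
    fderiv ℝ (fun z : ℝ × ℝ => a z.1 * b z.2) z (1, 0) = deriv a z.1 * b z.2 := by
  have h1 : HasFDerivAt (fun z : ℝ × ℝ => a z.1) _ z :=
    ((ha.differentiable (by simp)) z.1).hasDerivAt.comp_hasFDerivAt z
      (hasFDerivAt_fst (𝕜 := ℝ) (p := z))
  have h2 : HasFDerivAt (fun z : ℝ × ℝ => b z.2) _ z :=
    ((hb.differentiable (by simp)) z.2).hasDerivAt.comp_hasFDerivAt z
      (hasFDerivAt_snd (𝕜 := ℝ) (p := z))
  have h : fderiv ℝ (fun z : ℝ × ℝ => a z.1 * b z.2) z = _ := (h1.mul h2).fderiv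
  rw [h]
  simp [mul_comm]

lemma fderiv_mul_snd {a b : ℝ → ℝ} (ha : ContDiff ℝ ∞ a) (hb : ContDiff ℝ ∞ b) (z : ℝ × ℝ) :
    fderiv ℝ (fun z : ℝ × ℝ => a z.1 * b z.2) z (0, 1) = a z.1 * deriv b z.2 := by
  have h1 : HasFDerivAt (fun z : ℝ × ℝ => a z.1) _ z :=
    ((ha.differentiable (by simp)) z.1).hasDerivAt.comp_hasFDerivAt z
      (hasFDerivAt_fst (𝕜 := ℝ) (p := z))
  have h2 : HasFDerivAt (fun z : ℝ × ℝ => b z.2) _ z :=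
    ((hb.differentiable (by simp)) z.2).hasDerivAt.comp_hasFDerivAt z
      (hasFDerivAt_snd (𝕜 := ℝ) (p := z))
  have h : fderiv ℝ (fun z : ℝ × ℝ => a z.1 * b z.2) z = _ := (h1.mul h2).fderiv
  rw [h]
  simp

/-- The truncations of a product function are test functions. -/
lemma contDiff_truncation {a b : ℝ → ℝ} (ha : ContDiff ℝ ∞ a) (hb : ContDiff ℝ ∞ b) (n : ℕ) :
    ContDiff ℝ ∞ fun z : ℝ × ℝ => (cutoff n z.1 * a z.1) * (cutoff n z.2 * b z.2) :=
  ((contDiff_cutoff_mul ha n).comp contDiff_fst).mul ((contDiff_cutoff_mul hb n).comp contDiff_snd)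

lemma tsupport_truncation_subset (a b : ℝ → ℝ) (n : ℕ) :
    tsupport (fun z : ℝ × ℝ => (cutoff n z.1 * a z.1) * (cutoff n z.2 * b z.2)) ⊆ square := by
  have hcl : IsClosed {z : ℝ × ℝ | 1 ≤ n * (z.1 * (Real.pi - z.1)) ∧
      1 ≤ n * (z.2 * (Real.pi - z.2))} :=
    IsClosed.and (isClosed_le (by fun_prop) (by fun_prop))
      (isClosed_le (by fun_prop) (by fun_prop))
  refine (closure_minimal ?_ hcl).trans fun z hz => ⟨mem_Ioo_of_one_le hz.1, mem_Ioo_of_one_le hz.2⟩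
  intro z hz
  rw [Function.mem_support] at hz
  exact ⟨one_le_of_cutoff_ne_zero fun h => hz (by simp [h]),
    one_le_of_cutoff_ne_zero fun h => hz (by simp [h])⟩

lemma hasCompactSupport_of_tsupport_subset {φ : ℝ × ℝ → ℝ} (h : tsupport φ ⊆ square) :
    HasCompactSupport φ :=
  isCompact_closedSquare.of_isClosed_subset (isClosed_tsupport φ) (h.trans square_subset_closed)

lemma tendsto_integral_mul_of_bounded (u : L2) {F : ℕ → ℝ × ℝ → ℝ} {f : ℝ × ℝ → ℝ}
    (hF : ∀ n, Continuous (F n)) {C : ℝ} (hC : ∀ n, ∀ z ∈ square, |F n z| ≤ C)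
    (hlim : ∀ z ∈ square, Tendsto (fun n => F n z) atTop (𝓝 (f z))) :
    Tendsto (fun n => ∫ z in square, u z * F n z) atTop (𝓝 (∫ z in square, u z * f z)) := by
  refine tendsto_integral_of_dominated_convergence (fun z => |u z| * C)
    (fun n => (integrable_mul_continuous u (hF n)).aestronglyMeasurable)
    ((integrable_coe u).abs.mul_const C) (fun n => ?_) ?_
  · filter_upwards [ae_restrict_mem measurableSet_square] with z hz
    rw [Real.norm_eq_abs, abs_mul]
    gcongr
    exact hC n z hz
  · filter_upwards [ae_restrict_mem measurableSet_square] with z hz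
    exact (hlim z hz).const_mul _

/-- Weak derivatives in the first direction may be tested against products whose first factor
vanishes on the boundary. -/
lemma IsWeakDeriv.test_fst {v h : L2} (hv : IsWeakDeriv (1, 0) v h) {a b : ℝ → ℝ}
    (ha : ContDiff ℝ ∞ a) (hb : ContDiff ℝ ∞ b) {K : ℝ}
    (hK : ∀ x ∈ Ioo 0 Real.pi, |a x| ≤ K * (x * (Real.pi - x))) :
    ∫ z in square, v z * (deriv a z.1 * b z.2) = -∫ z in square, h z * (a z.1 * b z.2) := by
  obtain ⟨A, hA⟩ := exists_bound_cutoff_mul ha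
  obtain ⟨A', hA'⟩ := exists_bound_deriv_cutoff_mul ha hK
  obtain ⟨B, hB⟩ := exists_bound_cutoff_mul hb
  have e : ∀ n : ℕ, ∫ z in square, v z *
      (deriv (fun x => cutoff n x * a x) z.1 * (cutoff n z.2 * b z.2)) =
      -∫ z in square, h z * ((cutoff n z.1 * a z.1) * (cutoff n z.2 * b z.2)) := by
    intro n
    have hs := tsupport_truncation_subset a b n
    rw [← hv _ (contDiff_truncation ha hb n) (hasCompactSupport_of_tsupport_subset hs) hs]
    refine integral_congr_ae (Filter.Eventually.of_forall fun z => ?_)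
    simp only
    rw [← fderiv_mul_fst (contDiff_cutoff_mul ha n) (contDiff_cutoff_mul hb n)]
  have cont : ∀ {f : ℝ → ℝ}, ContDiff ℝ ∞ f → ∀ n, Continuous fun x => cutoff n x * f x :=
    fun hf n => (contDiff_cutoff_mul hf n).continuous
  have cont' : ∀ n, Continuous (deriv fun x => cutoff n x * a x) :=
    fun n => (contDiff_cutoff_mul ha n).continuous_deriv (by simp)
  have l1 := tendsto_integral_mul_of_bounded v (C := A' * B)
    (F := fun n z => deriv (fun x => cutoff n x * a x) z.1 * (cutoff n z.2 * b z.2))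
    (f := fun z => deriv a z.1 * b z.2)
    (fun n => ((cont' n).comp continuous_fst).mul ((cont hb n).comp continuous_snd))
    (fun n z hz => by
      rw [abs_mul]
      exact mul_le_mul (hA' n _ hz.1) (hB n _ hz.2) (abs_nonneg _)
        ((abs_nonneg _).trans (hA' n _ hz.1)))
    (fun z hz => (tendsto_deriv_cutoff_mul a hz.1).mul (tendsto_cutoff_mul b hz.2))
  have l2 := tendsto_integral_mul_of_bounded h (C := A * B)
    (F := fun n z => (cutoff n z.1 * a z.1) * (cutoff n z.2 * b z.2))
    (f := fun z => a z.1 * b z.2)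
    (fun n => ((cont ha n).comp continuous_fst).mul ((cont hb n).comp continuous_snd))
    (fun n z hz => by
      rw [abs_mul]
      exact mul_le_mul (hA n _ hz.1) (hB n _ hz.2) (abs_nonneg _)
        ((abs_nonneg _).trans (hA n _ hz.1)))
    (fun z hz => (tendsto_cutoff_mul a hz.1).mul (tendsto_cutoff_mul b hz.2))
  exact tendsto_nhds_unique l1 (l2.neg.congr fun n => (e n).symm)

/-- Weak derivatives in the second direction may be tested against products whose second factor
vanishes on the boundary. -/
lemma IsWeakDeriv.test_snd {v h : L2} (hv : IsWeakDeriv (0, 1) v h) {a b : ℝ → ℝ}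
    (ha : ContDiff ℝ ∞ a) (hb : ContDiff ℝ ∞ b) {K : ℝ}
    (hK : ∀ x ∈ Ioo 0 Real.pi, |b x| ≤ K * (x * (Real.pi - x))) :
    ∫ z in square, v z * (a z.1 * deriv b z.2) = -∫ z in square, h z * (a z.1 * b z.2) := by
  obtain ⟨A, hA⟩ := exists_bound_cutoff_mul ha
  obtain ⟨B', hB'⟩ := exists_bound_deriv_cutoff_mul hb hK
  obtain ⟨B, hB⟩ := exists_bound_cutoff_mul hb
  have e : ∀ n : ℕ, ∫ z in square, v z *
      ((cutoff n z.1 * a z.1) * deriv (fun x => cutoff n x * b x) z.2) =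
      -∫ z in square, h z * ((cutoff n z.1 * a z.1) * (cutoff n z.2 * b z.2)) := by
    intro n
    have hs := tsupport_truncation_subset a b n
    rw [← hv _ (contDiff_truncation ha hb n) (hasCompactSupport_of_tsupport_subset hs) hs]
    refine integral_congr_ae (Filter.Eventually.of_forall fun z => ?_)
    simp only
    rw [← fderiv_mul_snd (contDiff_cutoff_mul ha n) (contDiff_cutoff_mul hb n)]
  have cont : ∀ {f : ℝ → ℝ}, ContDiff ℝ ∞ f → ∀ n, Continuous fun x => cutoff n x * f x :=
    fun hf n => (contDiff_cutoff_mul hf n).continuous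
  have cont' : ∀ n, Continuous (deriv fun x => cutoff n x * b x) :=
    fun n => (contDiff_cutoff_mul hb n).continuous_deriv (by simp)
  have l1 := tendsto_integral_mul_of_bounded v (C := A * B')
    (F := fun n z => (cutoff n z.1 * a z.1) * deriv (fun x => cutoff n x * b x) z.2)
    (f := fun z => a z.1 * deriv b z.2)
    (fun n => ((cont ha n).comp continuous_fst).mul ((cont' n).comp continuous_snd))
    (fun n z hz => by
      rw [abs_mul]
      exact mul_le_mul (hA n _ hz.1) (hB' n _ hz.2) (abs_nonneg _)
        ((abs_nonneg _).trans (hA n _ hz.1)))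
    (fun z hz => (tendsto_cutoff_mul a hz.1).mul (tendsto_deriv_cutoff_mul b hz.2))
  have l2 := tendsto_integral_mul_of_bounded h (C := A * B)
    (F := fun n z => (cutoff n z.1 * a z.1) * (cutoff n z.2 * b z.2))
    (f := fun z => a z.1 * b z.2)
    (fun n => ((cont ha n).comp continuous_fst).mul ((cont hb n).comp continuous_snd))
    (fun n z hz => by
      rw [abs_mul]
      exact mul_le_mul (hA n _ hz.1) (hB n _ hz.2) (abs_nonneg _)
        ((abs_nonneg _).trans (hA n _ hz.1)))
    (fun z hz => (tendsto_cutoff_mul a hz.1).mul (tendsto_cutoff_mul b hz.2))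
  exact tendsto_nhds_unique l1 (l2.neg.congr fun n => (e n).symm)

/-! ### Weak derivatives of Lipschitz functions -/

/-- A function that is Lipschitz on the square has its pointwise directional derivatives as weak
derivatives. -/
lemma isWeakDeriv_of_lipschitzOn {f g : ℝ × ℝ → ℝ} {C : NNReal} (hf : LipschitzOnWith C f square)
    {e : ℝ × ℝ} (hg : ∀ z ∈ square, lineDeriv ℝ f z e = g z) (hf2 : MemLp f 2 squareMeasure)
    (hg2 : MemLp g 2 squareMeasure) : IsWeakDeriv e (hf2.toLp f) (hg2.toLp g) := by
  intro φ h1 h2 h3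
  -- Integration by parts for Lipschitz functions is available on the whole plane, so `f` is
  -- extended first; the support of `φ` makes the extension invisible.
  obtain ⟨F, hF, hfF⟩ := hf.extend_real
  obtain ⟨D, hD⟩ := (h1.of_le (by simp : (1 : WithTop ℕ∞) ≤ ∞)).lipschitzWith_of_hasCompactSupport
    h2 (by simp)
  have key := hF.integral_lineDeriv_mul_eq (μ := volume) hD h2 e
  have z1 : ∀ z ∉ square, φ z = 0 := fun z hz =>
    image_eq_zero_of_notMem_tsupport fun hz' => hz (h3 hz')
  have hline : ∀ z, lineDeriv ℝ φ z (-e) = - fderiv ℝ φ z e := fun z => by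
    rw [((h1.differentiable (by simp)) z).lineDeriv_eq_fderiv, map_neg]
  have z2 : ∀ z ∉ square, fderiv ℝ φ z e = 0 := fun z hz => by
    have : fderiv ℝ φ z = 0 := image_eq_zero_of_notMem_tsupport
      (fun hz' => hz (h3 (tsupport_fderiv_subset ℝ hz')))
    simp [this]
  have k1 : ∫ z in square, lineDeriv ℝ F z e * φ z = ∫ z, lineDeriv ℝ F z e * φ z :=
    setIntegral_eq_integral_of_forall_compl_eq_zero fun z hz => by rw [z1 z hz, mul_zero]
  have k2 : ∫ z in square, lineDeriv ℝ φ z (-e) * F z = ∫ z, lineDeriv ℝ φ z (-e) * F z :=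
    setIntegral_eq_integral_of_forall_compl_eq_zero fun z hz => by rw [hline, z2 z hz]; simp
  rw [← k1, ← k2] at key
  have e1 : ∫ z in square, (hf2.toLp f) z * fderiv ℝ φ z e =
      -∫ z in square, lineDeriv ℝ φ z (-e) * F z := by
    rw [← integral_neg]
    refine integral_congr_ae ?_
    filter_upwards [hf2.coeFn_toLp, ae_restrict_mem measurableSet_square] with z hz hzs
    rw [hz, hline, hfF hzs]
    ring
  have e2 : ∫ z in square, (hg2.toLp g) z * φ z = ∫ z in square, lineDeriv ℝ F z e * φ z := by
    refine integral_congr_ae ?_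
    filter_upwards [hg2.coeFn_toLp, ae_restrict_mem measurableSet_square] with z hz hzs
    have : f =ᶠ[𝓝 z] F := by
      filter_upwards [isOpen_square.mem_nhds hzs] with y hy using hfF hy
    rw [hz, ← hg z hzs, this.lineDeriv_eq]
  rw [e1, e2, key]

lemma exists_lipschitzOn_square {f : ℝ × ℝ → ℝ} (hf : ContDiff ℝ ∞ f) :
    ∃ C, LipschitzOnWith C f square := by
  obtain ⟨C, hC⟩ := isCompact_closedSquare.exists_bound_of_continuousOn
    (hf.continuous_fderiv (by simp)).continuousOn
  refine ⟨C.toNNReal, convex_square.lipschitzOnWith_of_nnnorm_fderiv_le (𝕜 := ℝ)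
    (fun z _ => (hf.differentiable (by simp)) z) fun z hz => ?_⟩
  rw [← NNReal.coe_le_coe, coe_nnnorm]
  exact (hC z (square_subset_closed hz)).trans (Real.le_coe_toNNReal C)

lemma isWeakGrad_of_contDiff {f : ℝ × ℝ → ℝ} (hf : ContDiff ℝ ∞ f) :
    IsWeakGrad (ofContinuous f hf.continuous)
      (ofContinuous (fun z => fderiv ℝ f z (1, 0)) (continuous_fderiv_dir hf _))
      (ofContinuous (fun z => fderiv ℝ f z (0, 1)) (continuous_fderiv_dir hf _)) := by
  obtain ⟨C, hC⟩ := exists_lipschitzOn_square hf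
  exact ⟨isWeakDeriv_of_lipschitzOn hC
      (fun z _ => ((hf.differentiable (by simp)) z).lineDeriv_eq_fderiv) _ _,
    isWeakDeriv_of_lipschitzOn hC
      (fun z _ => ((hf.differentiable (by simp)) z).lineDeriv_eq_fderiv) _ _⟩

/-! ### Cosine modes as Neumann eigenfunctions -/

/-- The eigenvalue of the mode `k`. -/
def modeEigenvalue (k : ℕ × ℕ) : ℝ := (k.1 : ℝ) ^ 2 + (k.2 : ℝ) ^ 2

/-- The function `cos (p x) cos (q y)`. -/
def cosFun (k : ℕ × ℕ) (z : ℝ × ℝ) : ℝ := Real.cos (k.1 * z.1) * Real.cos (k.2 * z.2)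

lemma contDiff_cosFun (k : ℕ × ℕ) : ContDiff ℝ ∞ (cosFun k) := by
  unfold cosFun; fun_prop

lemma continuous_cosFun (k : ℕ × ℕ) : Continuous (cosFun k) := (contDiff_cosFun k).continuous

/-- The mode `cos (p x) cos (q y)` as an element of `L²`. -/
def cosMode (k : ℕ × ℕ) : L2 := ofContinuous (cosFun k) (continuous_cosFun k)

/-- The derivative of the mode `k` in the direction `e`. -/
def cosModeDeriv (k : ℕ × ℕ) (e : ℝ × ℝ) : L2 :=
  ofContinuous (fun z => fderiv ℝ (cosFun k) z e) (continuous_fderiv_dir (contDiff_cosFun k) e)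

lemma isWeakGrad_cosMode (k : ℕ × ℕ) :
    IsWeakGrad (cosMode k) (cosModeDeriv k (1, 0)) (cosModeDeriv k (0, 1)) :=
  isWeakGrad_of_contDiff (contDiff_cosFun k)

lemma abs_sin_nat_mul_le (p : ℕ) {x : ℝ} (hx : x ∈ Ioo 0 Real.pi) :
    |Real.sin (p * x)| ≤ p * (x * (Real.pi - x)) := by
  have hp : (0 : ℝ) ≤ p := p.cast_nonneg
  -- On the left half `π - x > 1`, on the right half `x > 1`; so the distance to the nearer endpoint
  -- is at most `x (π - x)`.
  have hπ := Real.pi_gt_three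
  rcases le_or_gt x (Real.pi / 2) with h | h
  · have h1 : |Real.sin (p * x)| ≤ p * x := by
      have := Real.abs_sin_le_abs (x := p * x)
      rwa [abs_of_nonneg (mul_nonneg hp hx.1.le)] at this
    refine h1.trans (mul_le_mul_of_nonneg_left ?_ hp)
    nlinarith [hx.1]
  · have h0 : |Real.sin (p * x)| = |Real.sin (p * (Real.pi - x))| := by
      have : (p : ℝ) * (Real.pi - x) = p * Real.pi - p * x := by ring
      rw [this, Real.sin_nat_mul_pi_sub]
      rw [abs_neg, abs_mul, abs_pow, abs_neg, abs_one, one_pow, one_mul]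
    have h1 : |Real.sin (p * (Real.pi - x))| ≤ p * (Real.pi - x) := by
      have := Real.abs_sin_le_abs (x := p * (Real.pi - x))
      rwa [abs_of_nonneg (mul_nonneg hp (by linarith [hx.2]))] at this
    rw [h0]
    refine h1.trans (mul_le_mul_of_nonneg_left ?_ hp)
    nlinarith [hx.2]

lemma contDiff_cos_nat_mul (p : ℕ) : ContDiff ℝ ∞ fun x : ℝ => Real.cos (p * x) := by fun_prop

lemma contDiff_sin_nat_mul (p : ℕ) : ContDiff ℝ ∞ fun x : ℝ => Real.sin (p * x) := by fun_prop

lemma deriv_cos_nat_mul (p : ℕ) (x : ℝ) :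
    deriv (fun x : ℝ => Real.cos (p * x)) x = -(p * Real.sin (p * x)) := by
  have : HasDerivAt (fun x : ℝ => Real.cos (p * x)) (-Real.sin (p * x) * (p * 1)) x :=
    ((hasDerivAt_id' x).const_mul (p : ℝ)).cos
  rw [this.deriv]; ring

lemma deriv_sin_nat_mul (p : ℕ) (x : ℝ) :
    deriv (fun x : ℝ => Real.sin (p * x)) x = p * Real.cos (p * x) := by
  have : HasDerivAt (fun x : ℝ => Real.sin (p * x)) (Real.cos (p * x) * (p * 1)) x :=
    ((hasDerivAt_id' x).const_mul (p : ℝ)).sin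
  rw [this.deriv]; ring

lemma fderiv_cosFun_fst (k : ℕ × ℕ) (z : ℝ × ℝ) : fderiv ℝ (cosFun k) z (1, 0) =
    -(k.1 * (Real.sin (k.1 * z.1) * Real.cos (k.2 * z.2))) := by
  have := fderiv_mul_fst (contDiff_cos_nat_mul k.1) (contDiff_cos_nat_mul k.2) z
  rw [deriv_cos_nat_mul] at this
  rw [show cosFun k = fun z : ℝ × ℝ => Real.cos (k.1 * z.1) * Real.cos (k.2 * z.2) from rfl, this]
  ring

lemma fderiv_cosFun_snd (k : ℕ × ℕ) (z : ℝ × ℝ) : fderiv ℝ (cosFun k) z (0, 1) =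
    -(k.2 * (Real.cos (k.1 * z.1) * Real.sin (k.2 * z.2))) := by
  have := fderiv_mul_snd (contDiff_cos_nat_mul k.1) (contDiff_cos_nat_mul k.2) z
  rw [deriv_cos_nat_mul] at this
  rw [show cosFun k = fun z : ℝ × ℝ => Real.cos (k.1 * z.1) * Real.cos (k.2 * z.2) from rfl, this]
  ring

/-- The derivative of the mode is a multiple of `sin (p x) cos (q y)`, which vanishes on the two
vertical sides. Integrating by parts once more therefore leaves no boundary term, although `v` has
no boundary condition. -/
lemma IsWeakDeriv.inner_cosModeDeriv_fst {v h : L2} (hv : IsWeakDeriv (1, 0) v h) (k : ℕ × ℕ) :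
    inner ℝ h (cosModeDeriv k (1, 0)) = (k.1 : ℝ) ^ 2 * inner ℝ v (cosMode k) := by
  have := hv.test_fst (contDiff_sin_nat_mul k.1) (contDiff_cos_nat_mul k.2)
    (K := k.1) (fun x hx => abs_sin_nat_mul_le k.1 hx)
  simp only [deriv_sin_nat_mul] at this
  rw [cosModeDeriv, cosMode, inner_ofContinuous_right, inner_ofContinuous_right]
  simp only [fderiv_cosFun_fst, cosFun]
  calc _ = k.1 * (-∫ z in square, h z * (Real.sin (k.1 * z.1) * Real.cos (k.2 * z.2))) := by
        rw [← integral_neg, ← integral_const_mul]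
        congr 1; ext z; ring
    _ = _ := by
        rw [← this, ← integral_const_mul, ← integral_const_mul]
        congr 1; ext z; ring

lemma IsWeakDeriv.inner_cosModeDeriv_snd {v h : L2} (hv : IsWeakDeriv (0, 1) v h) (k : ℕ × ℕ) :
    inner ℝ h (cosModeDeriv k (0, 1)) = (k.2 : ℝ) ^ 2 * inner ℝ v (cosMode k) := by
  have := hv.test_snd (contDiff_cos_nat_mul k.1) (contDiff_sin_nat_mul k.2)
    (K := k.2) (fun x hx => abs_sin_nat_mul_le k.2 hx)
  simp only [deriv_sin_nat_mul] at this
  rw [cosModeDeriv, cosMode, inner_ofContinuous_right, inner_ofContinuous_right]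
  simp only [fderiv_cosFun_snd, cosFun]
  calc _ = k.2 * (-∫ z in square, h z * (Real.cos (k.1 * z.1) * Real.sin (k.2 * z.2))) := by
        rw [← integral_neg, ← integral_const_mul]
        congr 1; ext z; ring
    _ = _ := by
        rw [← this, ← integral_const_mul, ← integral_const_mul]
        congr 1; ext z; ring

lemma IsWeakGrad.inner_cosModeDeriv {v h₁ h₂ : L2} (hv : IsWeakGrad v h₁ h₂) (k : ℕ × ℕ) :
    inner ℝ h₁ (cosModeDeriv k (1, 0)) + inner ℝ h₂ (cosModeDeriv k (0, 1)) =
      modeEigenvalue k * inner ℝ v (cosMode k) := by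
  rw [hv.1.inner_cosModeDeriv_fst, hv.2.inner_cosModeDeriv_snd, modeEigenvalue]
  ring

lemma isNeumannLaplacian_cosMode (k : ℕ × ℕ) :
    IsNeumannLaplacian (cosMode k) (modeEigenvalue k • cosMode k) := by
  refine ⟨_, _, isWeakGrad_cosMode k, fun v h₁ h₂ hv => ?_⟩
  rw [real_inner_comm, real_inner_comm h₂, hv.inner_cosModeDeriv, real_inner_smul_left,
    real_inner_comm]

/-- Different modes may share the eigenvalue `p² + q²`, so symmetry of the Laplacian is not enough.
The identities in each direction separately recover `p` and `q`. -/
lemma inner_cosMode_of_ne {k l : ℕ × ℕ} (h : k ≠ l) : inner ℝ (cosMode k) (cosMode l) = 0 := by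
  have h1 := (isWeakGrad_cosMode k).1.inner_cosModeDeriv_fst l
  have h2 := (isWeakGrad_cosMode l).1.inner_cosModeDeriv_fst k
  have h3 := (isWeakGrad_cosMode k).2.inner_cosModeDeriv_snd l
  have h4 := (isWeakGrad_cosMode l).2.inner_cosModeDeriv_snd k
  rw [real_inner_comm, real_inner_comm (cosMode k)] at h2 h4
  by_contra h0
  have e1 := mul_right_cancel₀ h0 (h1.symm.trans h2)
  have e2 := mul_right_cancel₀ h0 (h3.symm.trans h4)
  rw [sq_eq_sq₀ (by positivity) (by positivity), Nat.cast_inj] at e1 e2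
  exact h (Prod.ext e1.symm e2.symm)

/-! ### Trigonometric polynomials and analytic continuation -/

/-- Finite linear combinations of the functions `cos (p x) cos (q y)`. -/
def trigPoly (s : Finset (ℕ × ℕ)) (c : ℕ × ℕ → ℝ) (z : ℝ × ℝ) : ℝ := ∑ k ∈ s, c k * cosFun k z

lemma analyticOnNhd_cosFun (k : ℕ × ℕ) : AnalyticOnNhd ℝ (cosFun k) univ := by
  intro z _
  have h1 : AnalyticAt ℝ (fun z : ℝ × ℝ => z.1) z := analyticAt_fst
  have h2 : AnalyticAt ℝ (fun z : ℝ × ℝ => z.2) z := analyticAt_snd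
  have c : ∀ w : ℝ, AnalyticAt ℝ Real.cos w := fun w => Real.analyticAt_cos
  exact ((c _).comp (analyticAt_const.mul h1)).mul ((c _).comp (analyticAt_const.mul h2))

lemma analyticOnNhd_trigPoly (s : Finset (ℕ × ℕ)) (c : ℕ × ℕ → ℝ) :
    AnalyticOnNhd ℝ (trigPoly s c) univ := by
  intro z _
  unfold trigPoly
  exact Finset.analyticAt_fun_sum _ fun k _ => analyticAt_const.mul (analyticOnNhd_cosFun k z trivial)

lemma contDiff_of_analyticOnNhd {f : ℝ × ℝ → ℝ} (hf : AnalyticOnNhd ℝ f univ) :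
    ContDiff ℝ ∞ f := contDiffOn_univ.1 (hf.contDiffOn uniqueDiffOn_univ)

lemma eq_zero_of_analyticOnNhd_of_eqOn_open {f : ℝ × ℝ → ℝ} (hf : AnalyticOnNhd ℝ f univ)
    {U : Set (ℝ × ℝ)} (hU : IsOpen U) (hne : U.Nonempty) (h : ∀ z ∈ U, f z = 0) : f = 0 := by
  obtain ⟨z, hz⟩ := hne
  exact hf.eq_of_eventuallyEq analyticOnNhd_const
    (z₀ := z) (by filter_upwards [hU.mem_nhds hz] with y hy using h y hy)

lemma square_nonempty : square.Nonempty :=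
  ⟨(Real.pi / 2, Real.pi / 2), by constructor <;> constructor <;> linarith [Real.pi_pos]⟩

lemma eqOn_of_ae_eq_square {f g : ℝ × ℝ → ℝ} (h : f =ᵐ[squareMeasure] g)
    (hf : ContinuousOn f square) (hg : ContinuousOn g square) : EqOn f g square :=
  Measure.eqOn_open_of_ae_eq h isOpen_square hf hg

lemma cosMode_ne_zero (k : ℕ × ℕ) : cosMode k ≠ 0 := by
  intro h
  have h1 : cosFun k =ᵐ[squareMeasure] fun _ => 0 := by
    have := (Lp.eq_zero_iff_ae_eq_zero).1 h
    exact (coeFn_ofContinuous (continuous_cosFun k)).symm.trans this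
  have h2 := eqOn_of_ae_eq_square h1 (continuous_cosFun k).continuousOn continuousOn_const
  have h3 := eq_zero_of_analyticOnNhd_of_eqOn_open (analyticOnNhd_cosFun k) isOpen_square
    square_nonempty h2
  have h4 := congrFun h3 (0, 0)
  simp [cosFun] at h4

/-! ### Completeness of the modes by Stone–Weierstrass -/

lemma cos_nat_mul_cos_nat_mul (p q : ℕ) (x : ℝ) : Real.cos (p * x) * Real.cos (q * x) =
    (Real.cos ((p + q : ℕ) * x) + Real.cos ((p - q : ℤ).natAbs * x)) / 2 := by
  have h : Real.cos ((p - q : ℤ).natAbs * x) = Real.cos ((p - q) * x) := by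
    have : (((p - q : ℤ).natAbs : ℕ) : ℝ) = |(p : ℝ) - q| := by
      rw [Nat.cast_natAbs]; push_cast; rfl
    rw [this]
    rcases abs_choice ((p : ℝ) - q) with h | h <;> rw [h]
    rw [neg_mul, Real.cos_neg]
  rw [h, Nat.cast_add, add_mul, sub_mul, Real.cos_add, Real.cos_sub]
  ring

lemma cosFun_mul_cosFun (k l : ℕ × ℕ) (z : ℝ × ℝ) : cosFun k z * cosFun l z =
    1 / 4 * (cosFun (k.1 + l.1, k.2 + l.2) z + cosFun (k.1 + l.1, (k.2 - l.2 : ℤ).natAbs) z +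
      cosFun ((k.1 - l.1 : ℤ).natAbs, k.2 + l.2) z +
      cosFun ((k.1 - l.1 : ℤ).natAbs, (k.2 - l.2 : ℤ).natAbs) z) := by
  have h1 := cos_nat_mul_cos_nat_mul k.1 l.1 z.1
  have h2 := cos_nat_mul_cos_nat_mul k.2 l.2 z.2
  simp only [cosFun]
  calc _ = (Real.cos (k.1 * z.1) * Real.cos (l.1 * z.1)) *
      (Real.cos (k.2 * z.2) * Real.cos (l.2 * z.2)) := by ring
    _ = _ := by rw [h1, h2]; ring

/-- The closed square. -/
abbrev closedSquare : Set (ℝ × ℝ) := Icc 0 Real.pi ×ˢ Icc 0 Real.pi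

instance compactSpace_closedSquare : CompactSpace closedSquare :=
  isCompact_iff_compactSpace.1 isCompact_closedSquare

/-- The restriction of `cosFun k` to the closed square. -/
def cosFunClosed (k : ℕ × ℕ) : C(closedSquare, ℝ) :=
  ⟨fun z => cosFun k z, (continuous_cosFun k).comp continuous_subtype_val⟩

/-- The algebra of cosine polynomials on the closed square. -/
def cosAlgebra : Subalgebra ℝ C(closedSquare, ℝ) :=
  (Submodule.span ℝ (range cosFunClosed)).toSubalgebra
    (Submodule.subset_span ⟨(0, 0), by ext z; simp [cosFunClosed, cosFun]⟩)
    (by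
      have hmul : Submodule.span ℝ (range cosFunClosed) * Submodule.span ℝ (range cosFunClosed) ≤
          Submodule.span ℝ (range cosFunClosed) := by
        rw [Submodule.span_mul_span, Submodule.span_le]
        rintro _ ⟨_, ⟨k, rfl⟩, _, ⟨l, rfl⟩, rfl⟩
        have : cosFunClosed k * cosFunClosed l = (1 / 4 : ℝ) •
            (cosFunClosed (k.1 + l.1, k.2 + l.2) +
              cosFunClosed (k.1 + l.1, (k.2 - l.2 : ℤ).natAbs) +
              cosFunClosed ((k.1 - l.1 : ℤ).natAbs, k.2 + l.2) +
              cosFunClosed ((k.1 - l.1 : ℤ).natAbs, (k.2 - l.2 : ℤ).natAbs)) := by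
          ext z
          exact cosFun_mul_cosFun k l z
        simp only [SetLike.mem_coe]
        rw [this]
        have hm : ∀ j, cosFunClosed j ∈ Submodule.span ℝ (range cosFunClosed) :=
          fun j => Submodule.subset_span ⟨j, rfl⟩
        exact Submodule.smul_mem _ _ (add_mem (add_mem (add_mem (hm _) (hm _)) (hm _)) (hm _))
      exact fun x y hx hy => hmul (Submodule.mul_mem_mul hx hy))

lemma mem_cosAlgebra_iff {f : C(closedSquare, ℝ)} :
    f ∈ cosAlgebra ↔ f ∈ Submodule.span ℝ (range cosFunClosed) := Iff.rfl

lemma cosAlgebra_separatesPoints : cosAlgebra.SeparatesPoints := by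
  intro z w hzw
  by_contra! h
  have h1 : ∀ k, cosFun k z = cosFun k w := fun k =>
    h _ ⟨cosFunClosed k, mem_cosAlgebra_iff.2 (Submodule.subset_span ⟨k, rfl⟩), rfl⟩
  have e1 := h1 (1, 0)
  have e2 := h1 (0, 1)
  simp only [cosFun, Nat.cast_one, Nat.cast_zero, zero_mul, one_mul, Real.cos_zero, mul_one] at e1 e2
  exact hzw (Subtype.ext (Prod.ext (Real.injOn_cos z.2.1 w.2.1 e1)
    (Real.injOn_cos z.2.2 w.2.2 e2)))

/-- The cosine modes are complete. -/
lemma eq_zero_of_inner_cosMode_eq_zero {u : L2} (h : ∀ k, inner ℝ u (cosMode k) = 0) : u = 0 := by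
  -- Elements of the algebra live on the closed square, while `L²` pairings use functions on the
  -- plane; each `f` is carried along with a continuous extension orthogonal to `u`.
  have hV : ∀ f ∈ Submodule.span ℝ (range cosFunClosed), ∃ g : ℝ × ℝ → ℝ, Continuous g ∧
      (∀ z : closedSquare, g z = f z) ∧ ∫ z in square, u z * g z = 0 := by
    intro f hf
    induction hf using Submodule.span_induction with
    | mem f hf =>
      obtain ⟨k, rfl⟩ := hf
      exact ⟨cosFun k, continuous_cosFun k, fun z => rfl,
        by rw [← inner_ofContinuous_right u (continuous_cosFun k)]; exact h k⟩
    | zero => exact ⟨fun _ => 0, continuous_const, fun z => rfl, by simp⟩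
    | add f₁ f₂ _ _ h₁ h₂ =>
      obtain ⟨g₁, c₁, e₁, i₁⟩ := h₁
      obtain ⟨g₂, c₂, e₂, i₂⟩ := h₂
      refine ⟨fun z => g₁ z + g₂ z, c₁.add c₂, fun z => by simp [e₁, e₂], ?_⟩
      simp only [mul_add]
      rw [integral_add (integrable_mul_continuous u c₁) (integrable_mul_continuous u c₂), i₁, i₂,
        add_zero]
    | smul a f _ h₁ =>
      obtain ⟨g₁, c₁, e₁, i₁⟩ := h₁
      refine ⟨fun z => a * g₁ z, continuous_const.mul c₁, fun z => by simp [e₁], ?_⟩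
      simp only [mul_left_comm _ a]
      rw [integral_const_mul, i₁, mul_zero]
  have htop := ContinuousMap.subalgebra_topologicalClosure_eq_top_of_separatesPoints cosAlgebra
    cosAlgebra_separatesPoints
  refine eq_zero_of_inner_test_eq_zero fun φ h1 _ _ => ?_
  let φK : C(closedSquare, ℝ) := ⟨fun z => φ z, h1.continuous.comp continuous_subtype_val⟩
  have hφK : φK ∈ closure (cosAlgebra : Set C(closedSquare, ℝ)) := by
    rw [← Subalgebra.topologicalClosure_coe, htop]; trivial
  have hε : ∀ ε > 0, |∫ z in square, u z * φ z| ≤ (∫ z in square, |u z|) * ε := by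
    intro ε hε
    obtain ⟨f, hf, hd⟩ := Metric.mem_closure_iff.1 hφK ε hε
    obtain ⟨g, cg, eg, ig⟩ := hV f hf
    have e : ∫ z in square, u z * φ z = ∫ z in square, u z * (φ z - g z) := by
      simp only [mul_sub]
      rw [integral_sub (integrable_mul_continuous u h1.continuous)
        (integrable_mul_continuous u cg), ig, sub_zero]
    rw [e, ← integral_mul_const]
    refine norm_integral_le_of_norm_le (f := fun z => u z * (φ z - g z))
      ((integrable_coe u).abs.mul_const ε) ?_
    filter_upwards [ae_restrict_mem measurableSet_square] with z hz
    rw [Real.norm_eq_abs, abs_mul]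
    gcongr
    have hz' : z ∈ closedSquare := square_subset_closed hz
    rw [eg ⟨z, hz'⟩]
    have := (ContinuousMap.dist_lt_iff hε).1 hd ⟨z, hz'⟩
    rw [Real.dist_eq] at this
    exact this.le
  have h0 : |∫ z in square, u z * φ z| ≤ 0 := by
    have ht : Tendsto (fun ε : ℝ => (∫ z in square, |u z|) * ε) (𝓝[>] 0) (𝓝 0) := by
      have : Tendsto (fun ε : ℝ => (∫ z in square, |u z|) * ε) (𝓝 0)
          (𝓝 ((∫ z in square, |u z|) * 0)) := tendsto_id.const_mul _
      rw [mul_zero] at this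
      exact this.mono_left nhdsWithin_le_nhds
    exact ge_of_tendsto ht (by filter_upwards [self_mem_nhdsWithin] with ε h using hε ε h)
  exact abs_nonpos_iff.1 h0

lemma orthonormal_cosMode : Orthonormal ℝ fun k => ‖cosMode k‖⁻¹ • cosMode k :=
  ⟨fun k => by
    rw [norm_smul, norm_inv, norm_norm, inv_mul_cancel₀ (norm_ne_zero_iff.2 (cosMode_ne_zero k))],
    fun k l hkl => by
      simp only [real_inner_smul_left, real_inner_smul_right, inner_cosMode_of_ne hkl, mul_zero]⟩

/-- The normalized cosine modes. -/
def cosBasis : HilbertBasis (ℕ × ℕ) ℝ L2 :=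
  HilbertBasis.mkOfOrthogonalEqBot orthonormal_cosMode
    (by
      rw [Submodule.eq_bot_iff]
      intro u hu
      refine eq_zero_of_inner_cosMode_eq_zero fun k => ?_
      have := hu _ (Submodule.subset_span ⟨k, rfl⟩)
      rw [real_inner_smul_left] at this
      rw [real_inner_comm]
      exact (mul_eq_zero.1 this).resolve_left
        (inv_ne_zero (norm_ne_zero_iff.2 (cosMode_ne_zero k))))

lemma cosBasis_apply (k : ℕ × ℕ) : cosBasis k = ‖cosMode k‖⁻¹ • cosMode k := by
  rw [cosBasis, HilbertBasis.coe_mkOfOrthogonalEqBot]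

lemma inner_cosBasis_eq_zero_iff {u : L2} {k : ℕ × ℕ} :
    inner ℝ u (cosBasis k) = 0 ↔ inner ℝ u (cosMode k) = 0 := by
  rw [cosBasis_apply, real_inner_smul_right, mul_eq_zero,
    or_iff_right (inv_ne_zero (norm_ne_zero_iff.2 (cosMode_ne_zero k)))]

/-- The Hilbert basis expansion has only finitely many nonzero terms, so it is an explicit sum with
an analytic representative. -/
lemma exists_eq_trigPoly {u : L2} (s : Finset (ℕ × ℕ))
    (h : ∀ k ∉ s, inner ℝ u (cosMode k) = 0) :
    ∃ c, (u : ℝ × ℝ → ℝ) =ᵐ[squareMeasure] trigPoly s c := by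
  have h1 : u = ∑ k ∈ s, cosBasis.repr u k • cosBasis k := by
    refine (cosBasis.hasSum_repr u).unique (hasSum_sum_of_ne_finset_zero fun k hk => ?_)
    rw [cosBasis.repr_apply_apply, real_inner_comm, inner_cosBasis_eq_zero_iff.2 (h k hk), zero_smul]
  have h2 : ∀ (s : Finset (ℕ × ℕ)) (c : ℕ × ℕ → ℝ),
      ((∑ k ∈ s, c k • cosMode k : L2) : ℝ × ℝ → ℝ) =ᵐ[squareMeasure] trigPoly s c := by
    intro s c
    classical
    induction s using Finset.induction_on with
    | empty =>
      filter_upwards [Lp.coeFn_zero ℝ 2 squareMeasure] with z hz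
      simpa [trigPoly] using hz
    | insert a s ha ih =>
      rw [Finset.sum_insert ha]
      filter_upwards [ih, Lp.coeFn_add (c a • cosMode a) (∑ k ∈ s, c k • cosMode k),
        Lp.coeFn_smul (c a) (cosMode a), coeFn_ofContinuous (continuous_cosFun a)] with z h1 h2 h3 h4
      rw [h2, Pi.add_apply, h1, h3, Pi.smul_apply, cosMode, h4]
      simp [trigPoly, Finset.sum_insert ha]
  refine ⟨fun k => cosBasis.repr u k * ‖cosMode k‖⁻¹, ?_⟩
  have h3 := h2 s fun k => cosBasis.repr u k * ‖cosMode k‖⁻¹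
  have h4 : u = ∑ k ∈ s, (cosBasis.repr u k * ‖cosMode k‖⁻¹) • cosMode k := by
    conv_lhs => rw [h1]
    exact Finset.sum_congr rfl fun k _ => by rw [cosBasis_apply, smul_smul]
  rwa [← h4] at h3

lemma finite_modeEigenvalue_le (t : ℝ) : {k | modeEigenvalue k ≤ t}.Finite := by
  obtain ⟨N, hN⟩ := exists_nat_gt t
  refine ((finite_Iic N).prod (finite_Iic N)).subset fun k hk => ?_
  have hk' : modeEigenvalue k ≤ t := hk
  have h : k.1 ^ 2 + k.2 ^ 2 < N := by
    have : ((k.1 ^ 2 + k.2 ^ 2 : ℕ) : ℝ) < N := by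
      push_cast; exact hk'.trans_lt hN
    exact_mod_cast this
  exact ⟨by simp only [mem_Iic]; nlinarith, by simp only [mem_Iic]; nlinarith⟩

/-! ### Energy and the spectral expansion -/

/-- Bessel's inequality for the energy. -/
lemma IsWeakGrad.sum_modeEigenvalue_mul_sq_le {w g₁ g₂ : L2} (hw : IsWeakGrad w g₁ g₂)
    (s : Finset (ℕ × ℕ)) :
    ∑ k ∈ s, modeEigenvalue k * inner ℝ w (cosBasis k) ^ 2 ≤ inner ℝ g₁ g₁ + inner ℝ g₂ g₂ := by
  set c : ℕ × ℕ → ℝ := fun k => inner ℝ w (cosBasis k) with hc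
  set d : ℕ × ℕ → ℝ := fun k => c k * ‖cosMode k‖⁻¹ with hd
  set G₁ : L2 := ∑ k ∈ s, d k • cosModeDeriv k (1, 0) with hG₁
  set G₂ : L2 := ∑ k ∈ s, d k • cosModeDeriv k (0, 1) with hG₂
  have hG : IsWeakGrad (∑ k ∈ s, d k • cosMode k) G₁ G₂ :=
    IsWeakGrad.sum s fun k _ => (isWeakGrad_cosMode k).smul (d k)
  have hsum : ∑ k ∈ s, d k • cosMode k = ∑ k ∈ s, c k • cosBasis k :=
    Finset.sum_congr rfl fun k _ => by rw [cosBasis_apply, smul_smul]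
  have key : ∀ {v h₁ h₂ : L2}, IsWeakGrad v h₁ h₂ → inner ℝ h₁ G₁ + inner ℝ h₂ G₂ =
      ∑ k ∈ s, modeEigenvalue k * (c k * inner ℝ v (cosBasis k)) := by
    intro v h₁ h₂ hv
    rw [hG₁, hG₂, inner_sum, inner_sum, ← Finset.sum_add_distrib]
    refine Finset.sum_congr rfl fun k _ => ?_
    rw [real_inner_smul_right, real_inner_smul_right, ← mul_add, hv.inner_cosModeDeriv,
      cosBasis_apply, real_inner_smul_right]
    ring
  have k1 := key hw
  have k2 := key hG
  have k3 : ∀ k ∈ s, inner ℝ (∑ k ∈ s, d k • cosMode k) (cosBasis k) = c k := by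
    intro k hk
    rw [hsum]
    exact cosBasis.orthonormal.inner_left_sum c hk
  rw [Finset.sum_congr rfl fun k hk => by rw [k3 k hk]] at k2
  -- Bessel's argument for gradients: expand `‖∇w - G‖² ≥ 0`, where both the cross term `⟨∇w, G⟩`
  -- and `‖G‖²` equal the sum in question.
  have p1 : 0 ≤ inner ℝ (g₁ - G₁) (g₁ - G₁) := real_inner_self_nonneg
  have p2 : 0 ≤ inner ℝ (g₂ - G₂) (g₂ - G₂) := real_inner_self_nonneg
  rw [real_inner_sub_sub_self] at p1 p2
  have e : ∑ k ∈ s, modeEigenvalue k * inner ℝ w (cosBasis k) ^ 2 =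
      ∑ k ∈ s, modeEigenvalue k * (c k * c k) := Finset.sum_congr rfl fun k _ => by rw [sq]
  rw [e]
  linarith

/-- A function of energy at most `t` times its mass that is orthogonal to the modes below `t` is
orthogonal to the modes above `t`. -/
lemma IsWeakGrad.inner_cosMode_eq_zero {w g₁ g₂ : L2} (hw : IsWeakGrad w g₁ g₂) {t : ℝ}
    (hen : inner ℝ g₁ g₁ + inner ℝ g₂ g₂ ≤ t * inner ℝ w w)
    (hlow : ∀ k, modeEigenvalue k < t → inner ℝ w (cosMode k) = 0) {k : ℕ × ℕ}
    (hk : modeEigenvalue k ≠ t) : inner ℝ w (cosMode k) = 0 := by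
  rcases hk.lt_or_gt with hk | hk
  · exact hlow k hk
  have hterm : ∀ l, 0 ≤ (modeEigenvalue l - t) * inner ℝ w (cosBasis l) ^ 2 := by
    intro l
    rcases lt_or_ge (modeEigenvalue l) t with h | h
    · rw [inner_cosBasis_eq_zero_iff.2 (hlow l h)]; simp
    · exact mul_nonneg (sub_nonneg.2 h) (sq_nonneg _)
  have hS : HasSum (fun l => inner ℝ w (cosBasis l) ^ 2) (inner ℝ w w) := by
    refine (cosBasis.hasSum_inner_mul_inner w w).congr_fun ?_
    intro l
    rw [real_inner_comm w, sq]
  have hlim : Tendsto (fun s : Finset (ℕ × ℕ) => inner ℝ g₁ g₁ + inner ℝ g₂ g₂ -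
      t * ∑ l ∈ s, inner ℝ w (cosBasis l) ^ 2) atTop
      (𝓝 (inner ℝ g₁ g₁ + inner ℝ g₂ g₂ - t * inner ℝ w w)) :=
    tendsto_const_nhds.sub (Tendsto.const_mul t hS)
  -- All terms `(λ_l - t) c_l²` are nonnegative, since the modes below `t` are absent. A single one
  -- is thus bounded by energy minus `t` times mass, which is at most 0.
  have hle : (modeEigenvalue k - t) * inner ℝ w (cosBasis k) ^ 2 ≤
      inner ℝ g₁ g₁ + inner ℝ g₂ g₂ - t * inner ℝ w w := by
    refine ge_of_tendsto hlim ?_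
    filter_upwards [eventually_ge_atTop {k}] with s hs
    have h1 := hw.sum_modeEigenvalue_mul_sq_le s
    have h2 := Finset.single_le_sum (f := fun l => (modeEigenvalue l - t) *
      inner ℝ w (cosBasis l) ^ 2) (fun l _ => hterm l) (hs (Finset.mem_singleton_self k))
    have h3 : ∑ l ∈ s, (modeEigenvalue l - t) * inner ℝ w (cosBasis l) ^ 2 =
        ∑ l ∈ s, modeEigenvalue l * inner ℝ w (cosBasis l) ^ 2 -
          t * ∑ l ∈ s, inner ℝ w (cosBasis l) ^ 2 := by
      rw [Finset.mul_sum, ← Finset.sum_sub_distrib]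
      exact Finset.sum_congr rfl fun l _ => by ring
    linarith
  rw [← inner_cosBasis_eq_zero_iff]
  by_contra h0
  have : 0 < (modeEigenvalue k - t) * inner ℝ w (cosBasis k) ^ 2 :=
    mul_pos (sub_pos.2 hk) (by positivity)
  linarith

/-! ### Nodal domains and truncation to them -/

lemma isOpen_nonzeroSet {P : ℝ × ℝ → ℝ} (hP : Continuous P) : IsOpen {z ∈ square | P z ≠ 0} :=
  isOpen_square.inter (isOpen_ne_fun hP continuous_const)

section NodalDomain

variable {P : ℝ × ℝ → ℝ} {D : Set (ℝ × ℝ)}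

lemma nodalDomain_subset (hD : D ∈ nodalDomains P) : D ⊆ {z ∈ square | P z ≠ 0} := by
  obtain ⟨x, _, rfl⟩ := hD
  exact connectedComponentIn_subset _ _

lemma nodalDomain_nonempty (hD : D ∈ nodalDomains P) : D.Nonempty := by
  obtain ⟨x, hx, rfl⟩ := hD
  exact ⟨x, mem_connectedComponentIn hx⟩

lemma isPreconnected_nodalDomain (hD : D ∈ nodalDomains P) : IsPreconnected D := by
  obtain ⟨x, _, rfl⟩ := hD
  exact isPreconnected_connectedComponentIn

lemma nodalDomain_eq (hD : D ∈ nodalDomains P) {x : ℝ × ℝ} (hx : x ∈ D) :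
    connectedComponentIn {z ∈ square | P z ≠ 0} x = D := by
  obtain ⟨y, _, rfl⟩ := hD
  exact (connectedComponentIn_eq hx).symm

lemma nodalDomain_eq_of_mem {D' : Set (ℝ × ℝ)} (hD : D ∈ nodalDomains P)
    (hD' : D' ∈ nodalDomains P) {x : ℝ × ℝ} (hx : x ∈ D) (hx' : x ∈ D') : D = D' := by
  rw [← nodalDomain_eq hD hx, nodalDomain_eq hD' hx']

lemma isOpen_nodalDomain (hP : Continuous P) (hD : D ∈ nodalDomains P) : IsOpen D := by
  obtain ⟨x, _, rfl⟩ := hD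
  exact (isOpen_nonzeroSet hP).connectedComponentIn

lemma nodalDomain_sign (hP : Continuous P) (hD : D ∈ nodalDomains P) :
    (∀ z ∈ D, 0 < P z) ∨ ∀ z ∈ D, P z < 0 := by
  by_contra! h
  obtain ⟨⟨x, hx, hx0⟩, y, hy, hy0⟩ := h
  obtain ⟨z, hz, hz0⟩ := (isPreconnected_nodalDomain hD).intermediate_value hx hy hP.continuousOn
    ⟨hx0, hy0⟩
  exact (nodalDomain_subset hD hz).2 hz0

lemma exists_zero_mem_segment (hD : D ∈ nodalDomains P) {x y : ℝ × ℝ} (hx : x ∈ D)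
    (hy : y ∈ square) (hyD : y ∉ D) : ∃ z ∈ segment ℝ x y, P z = 0 := by
  by_contra! h
  have hx' := nodalDomain_subset hD hx
  have hsub : segment ℝ x y ⊆ {z ∈ square | P z ≠ 0} := fun z hz =>
    ⟨convex_square.segment_subset hx'.1 hy hz, h z hz⟩
  have := (convex_segment x y).isPreconnected.subset_connectedComponentIn
    (left_mem_segment ℝ x y) hsub (right_mem_segment ℝ x y)
  rw [nodalDomain_eq hD hx] at this
  exact hyD this

/-- A segment leaving `D` inside the square meets a zero of `P`, so the value at its start is
controlled by the part of the segment up to that zero. Extension by zero keeps the Lipschitz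
constant, with no regularity of the boundary of `D`. -/
lemma lipschitzOn_indicator_nodalDomain (hD : D ∈ nodalDomains P) {C : NNReal}
    (hC : LipschitzOnWith C P square) : LipschitzOnWith C (D.indicator P) square := by
  have key : ∀ x ∈ D, ∀ y ∈ square, y ∉ D → |P x| ≤ C * dist x y := by
    intro x hx y hy hyD
    obtain ⟨z, hz, hz0⟩ := exists_zero_mem_segment hD hx hy hyD
    have hx' := (nodalDomain_subset hD hx).1
    have h1 := hC.dist_le_mul x hx' z (convex_square.segment_subset hx' hy hz)
    rw [hz0, Real.dist_0_eq_abs] at h1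
    have h2 : dist x z ≤ dist x y := by
      have := dist_add_dist_of_mem_segment hz
      linarith [dist_nonneg (x := z) (y := y)]
    exact h1.trans (by gcongr)
  refine LipschitzOnWith.of_dist_le_mul fun x hx y hy => ?_
  by_cases hxD : x ∈ D <;> by_cases hyD : y ∈ D
  · rw [indicator_of_mem hxD, indicator_of_mem hyD]; exact hC.dist_le_mul x hx y hy
  · rw [indicator_of_mem hxD, indicator_of_notMem hyD, Real.dist_0_eq_abs]
    exact key x hxD y hy hyD
  · rw [indicator_of_notMem hxD, indicator_of_mem hyD, dist_comm, Real.dist_0_eq_abs, dist_comm]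
    exact key y hyD x hx hxD
  · rw [indicator_of_notMem hxD, indicator_of_notMem hyD, dist_self]; positivity

/-- Since `P` has one sign on `D`, the truncation has an extremum, namely 0, at each point off `D`
along every line. The derivative `deriv` is zero there, by its default value if it does not exist,
so boundary points need no separate treatment. -/
lemma lineDeriv_indicator_nodalDomain (hP : ContDiff ℝ ∞ P) (hD : D ∈ nodalDomains P)
    (z e : ℝ × ℝ) :
    lineDeriv ℝ (D.indicator P) z e = D.indicator (fun z => fderiv ℝ P z e) z := by
  by_cases hz : z ∈ D
  · have : D.indicator P =ᶠ[𝓝 z] P := by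
      filter_upwards [(isOpen_nodalDomain hP.continuous hD).mem_nhds hz] with y hy
      exact indicator_of_mem hy P
    rw [this.lineDeriv_eq, indicator_of_mem hz,
      ((hP.differentiable (by simp)) z).lineDeriv_eq_fderiv]
  · rw [indicator_of_notMem hz, lineDeriv]
    have h0 : D.indicator P (z + (0 : ℝ) • e) = 0 := by
      rw [zero_smul, add_zero, indicator_of_notMem hz]
    rcases nodalDomain_sign hP.continuous hD with h | h
    · refine IsLocalMin.deriv_eq_zero (Eventually.of_forall fun s => ?_)
      simp only [h0]
      exact indicator_nonneg (fun w hw => (h w hw).le) _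
    · refine IsLocalMax.deriv_eq_zero (Eventually.of_forall fun s => ?_)
      simp only [h0]
      exact indicator_nonpos (fun w hw => (h w hw).le) _

end NodalDomain

/-- The restriction of a continuous function to a measurable set, as an element of `L²`. -/
def restrictTo (f : ℝ × ℝ → ℝ) (hf : Continuous f) {D : Set (ℝ × ℝ)} (hD : MeasurableSet D) : L2 :=
  ((memLp_of_continuous hf).indicator hD).toLp _

lemma isWeakGrad_restrictTo {P : ℝ × ℝ → ℝ} (hP : ContDiff ℝ ∞ P) {D : Set (ℝ × ℝ)}
    (hD : D ∈ nodalDomains P) (hDm : MeasurableSet D) :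
    IsWeakGrad (restrictTo P hP.continuous hDm)
      (restrictTo _ (continuous_fderiv_dir hP (1, 0)) hDm)
      (restrictTo _ (continuous_fderiv_dir hP (0, 1)) hDm) := by
  obtain ⟨C, hC⟩ := exists_lipschitzOn_square hP
  have hL := lipschitzOn_indicator_nodalDomain hD hC
  exact ⟨isWeakDeriv_of_lipschitzOn hL (fun z _ => lineDeriv_indicator_nodalDomain hP hD z _) _ _,
    isWeakDeriv_of_lipschitzOn hL (fun z _ => lineDeriv_indicator_nodalDomain hP hD z _) _ _⟩

/-! ### Functions proportional to an eigenfunction on each nodal domain -/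

section NodalSum

variable {ι : Type*} [Fintype ι] {D : ι → Set (ℝ × ℝ)} (hDm : ∀ i, MeasurableSet (D i))

/-- The function equal to `b i * f` on `D i`. -/
def nodalSum (f : ℝ × ℝ → ℝ) (hf : Continuous f) (hDm : ∀ i, MeasurableSet (D i)) (b : ι → ℝ) :
    L2 := ∑ i, b i • restrictTo f hf (hDm i)

/-- Cross terms vanish by disjointness. The right side is linear in a nodal sum with squared
coefficients, and this sum can serve as a test function. -/
lemma inner_nodalSum_self (hdisj : Pairwise fun i j => Disjoint (D i) (D j)) {f : ℝ × ℝ → ℝ}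
    (hf : Continuous f) (b : ι → ℝ) :
    inner ℝ (nodalSum f hf hDm b) (nodalSum f hf hDm b) =
      inner ℝ (ofContinuous f hf) (nodalSum f hf hDm fun i => b i ^ 2) := by
  have h1 : ∀ i j, i ≠ j → inner ℝ (restrictTo f hf (hDm i)) (restrictTo f hf (hDm j)) = 0 := by
    intro i j hij
    rw [restrictTo, restrictTo, inner_toLp_toLp]
    refine integral_eq_zero_of_ae (Eventually.of_forall fun z => ?_)
    by_cases hz : z ∈ D i
    · simp [indicator_of_notMem (disjoint_left.1 (hdisj hij) hz)]
    · simp [indicator_of_notMem hz]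
  have h2 : ∀ i, inner ℝ (restrictTo f hf (hDm i)) (restrictTo f hf (hDm i)) =
      inner ℝ (ofContinuous f hf) (restrictTo f hf (hDm i)) := by
    intro i
    rw [restrictTo, ofContinuous, inner_toLp_toLp, inner_toLp_toLp]
    refine integral_congr_ae (Eventually.of_forall fun z => ?_)
    by_cases hz : z ∈ D i <;> simp [hz]
  rw [nodalSum, nodalSum, inner_sum, inner_sum]
  refine Finset.sum_congr rfl fun i _ => ?_
  rw [sum_inner, Finset.sum_eq_single i (fun j _ hj => ?_) (by simp), real_inner_smul_left,
    real_inner_smul_right, real_inner_smul_right, h2]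
  · ring
  · rw [real_inner_smul_left, real_inner_smul_right, h1 j i hj]; simp

lemma coeFn_nodalSum {f : ℝ × ℝ → ℝ} (hf : Continuous f) (b : ι → ℝ) :
    (nodalSum f hf hDm b : ℝ × ℝ → ℝ) =ᵐ[squareMeasure]
      fun z => ∑ i, b i * (D i).indicator f z := by
  have h : ∀ s : Finset ι, ((∑ i ∈ s, b i • restrictTo f hf (hDm i) : L2) : ℝ × ℝ → ℝ)
      =ᵐ[squareMeasure] fun z => ∑ i ∈ s, b i * (D i).indicator f z := by
    intro s
    classical
    induction s using Finset.induction_on with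
    | empty =>
      filter_upwards [Lp.coeFn_zero ℝ 2 squareMeasure] with z hz
      simpa using hz
    | insert a s ha ih =>
      simp only [Finset.sum_insert ha]
      filter_upwards [ih, Lp.coeFn_add (b a • restrictTo f hf (hDm a))
          (∑ i ∈ s, b i • restrictTo f hf (hDm i)),
        Lp.coeFn_smul (b a) (restrictTo f hf (hDm a)),
        ((memLp_of_continuous hf).indicator (hDm a)).coeFn_toLp] with z h1 h2 h3 h4
      rw [h2, Pi.add_apply, h1, h3, Pi.smul_apply, restrictTo, h4, smul_eq_mul]
  exact h Finset.univ

lemma sum_mul_indicator_of_mem (hdisj : Pairwise fun i j => Disjoint (D i) (D j))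
    (f : ℝ × ℝ → ℝ) (b : ι → ℝ) {z : ℝ × ℝ} {j : ι} (hz : z ∈ D j) :
    ∑ i, b i * (D i).indicator f z = b j * f z := by
  rw [Finset.sum_eq_single j (fun i _ hij => ?_) (by simp), indicator_of_mem hz]
  rw [indicator_of_notMem (disjoint_left.1 (hdisj hij.symm) hz), mul_zero]

lemma isWeakGrad_nodalSum {P : ℝ × ℝ → ℝ} (hP : ContDiff ℝ ∞ P) (hD : ∀ i, D i ∈ nodalDomains P)
    (b : ι → ℝ) :
    IsWeakGrad (nodalSum P hP.continuous hDm b)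
      (nodalSum _ (continuous_fderiv_dir hP (1, 0)) hDm b)
      (nodalSum _ (continuous_fderiv_dir hP (0, 1)) hDm b) :=
  IsWeakGrad.sum _ fun i _ => (isWeakGrad_restrictTo hP (hD i) (hDm i)).smul (b i)

/-- On nodal domains of an eigenfunction the energy is proportional to the mass. -/
lemma energy_nodalSum {P : ℝ × ℝ → ℝ} (hP : ContDiff ℝ ∞ P) (hD : ∀ i, D i ∈ nodalDomains P)
    (hdisj : Pairwise fun i j => Disjoint (D i) (D j)) {t : ℝ}
    (hPt : IsNeumannLaplacian (ofContinuous P hP.continuous) (t • ofContinuous P hP.continuous))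
    (b : ι → ℝ) :
    inner ℝ (nodalSum _ (continuous_fderiv_dir hP (1, 0)) hDm b)
        (nodalSum _ (continuous_fderiv_dir hP (1, 0)) hDm b) +
      inner ℝ (nodalSum _ (continuous_fderiv_dir hP (0, 1)) hDm b)
        (nodalSum _ (continuous_fderiv_dir hP (0, 1)) hDm b) =
      t * inner ℝ (nodalSum P hP.continuous hDm b) (nodalSum P hP.continuous hDm b) := by
  obtain ⟨g₁, g₂, hg, H⟩ := hPt
  obtain ⟨rfl, rfl⟩ := hg.unique (isWeakGrad_of_contDiff hP)
  -- The energy becomes the pairing of `∇P` with the gradient of the nodal sum with coefficients `b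
  -- i ^ 2`, so the weak eigenvalue equation for `P` applies.
  rw [inner_nodalSum_self hDm hdisj, inner_nodalSum_self hDm hdisj,
    inner_nodalSum_self hDm hdisj, H _ _ _ (isWeakGrad_nodalSum hDm hP hD _), real_inner_smul_left]

end NodalSum

/-! ### Courant's argument -/

lemma eqOn_zero_of_ae {f : ℝ × ℝ → ℝ} (hf : Continuous f) {U : Set (ℝ × ℝ)} (hU : IsOpen U)
    (hUs : U ⊆ square) (h : ∀ᵐ z ∂squareMeasure, z ∈ U → f z = 0) : ∀ z ∈ U, f z = 0 := by
  have h1 : f =ᵐ[volume.restrict U] fun _ => 0 := by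
    rw [Filter.EventuallyEq, ae_restrict_iff' hU.measurableSet]
    filter_upwards [(ae_restrict_iff' measurableSet_square).1 h] with z hz hzU
    exact hz (hUs hzU) hzU
  exact Measure.eqOn_open_of_ae_eq h1 hU hf.continuousOn continuousOn_const

/-- Courant's bound, for families of nodal domains labelled by `ℓ`, in a symmetry class with modes
`S`. -/
theorem card_label_le {P : ℝ × ℝ → ℝ} (hP : ContDiff ℝ ∞ P) {t : ℝ}
    (hPt : IsNeumannLaplacian (ofContinuous P hP.continuous) (t • ofContinuous P hP.continuous))
    {ι : Type*} [Fintype ι] {D : ι → Set (ℝ × ℝ)} (hD : ∀ i, D i ∈ nodalDomains P)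
    (hinj : Function.Injective D) (hDm : ∀ i, MeasurableSet (D i))
    {κ : Type*} [Fintype κ] (ℓ : ι → κ) (hℓ : Function.Surjective ℓ) (S : Set (ℕ × ℕ))
    (hS : ∀ a : κ → ℝ, ∀ k ∉ S,
      inner ℝ (nodalSum P hP.continuous hDm fun i => a (ℓ i)) (cosMode k) = 0) :
    Fintype.card κ ≤ {k ∈ S | modeEigenvalue k < t}.ncard + 1 := by
  have hfin : {k ∈ S | modeEigenvalue k < t}.Finite :=
    (finite_modeEigenvalue_le t).subset fun k hk => hk.2.le
  have hdisj : Pairwise fun i j => Disjoint (D i) (D j) := fun i j hij =>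
    disjoint_left.2 fun z hz hz' => hij (hinj (nodalDomain_eq_of_mem (hD i) (hD j) hz hz'))
  by_contra! hlt
  obtain ⟨q⟩ : Nonempty κ := Fintype.card_pos_iff.1 (by omega)
  have := hfin.fintype
  -- One unknown per label; one condition per mode of `S` below `t`, plus the condition that the
  -- coefficient of `q` vanish. This last condition is the `+ 1` in the bound, and it supplies an
  -- open set on which the function is zero.
  let Φ : (κ → ℝ) →ₗ[ℝ] ({k ∈ S | modeEigenvalue k < t} → ℝ) × ℝ :=
    (LinearMap.pi fun k : {k ∈ S | modeEigenvalue k < t} =>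
      ∑ i, inner ℝ (restrictTo P hP.continuous (hDm i)) (cosMode k) •
        (LinearMap.proj (ℓ i) : (κ → ℝ) →ₗ[ℝ] ℝ)).prod (LinearMap.proj q)
  have hker : LinearMap.ker Φ ≠ ⊥ := by
    refine LinearMap.ker_ne_bot_of_finrank_lt ?_
    rw [Module.finrank_prod, Module.finrank_fintype_fun_eq_card, Module.finrank_self,
      Module.finrank_fintype_fun_eq_card, ← Nat.card_eq_fintype_card, Nat.card_coe_set_eq]
    exact hlt
  obtain ⟨a, ha, ha0⟩ := Submodule.exists_mem_ne_zero_of_ne_bot hker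
  rw [LinearMap.mem_ker] at ha
  have haq : a q = 0 := congrArg Prod.snd ha
  have hak : ∀ k ∈ {k ∈ S | modeEigenvalue k < t},
      inner ℝ (nodalSum P hP.continuous hDm fun i => a (ℓ i)) (cosMode k) = 0 := by
    intro k hk
    have h1 := congrFun (congrArg Prod.fst ha) ⟨k, hk⟩
    simp only [Φ, LinearMap.prod_apply, Function.prod, LinearMap.pi_apply, LinearMap.sum_apply,
      LinearMap.smul_apply, LinearMap.proj_apply, smul_eq_mul] at h1
    rw [nodalSum, sum_inner]
    refine Eq.trans ?_ h1
    exact Finset.sum_congr rfl fun i _ => by rw [real_inner_smul_left, mul_comm]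
  set w := nodalSum P hP.continuous hDm fun i => a (ℓ i) with hw
  -- Modes of `S` below `t` are excluded by the choice of `a`, those outside `S` by symmetry, and
  -- those above `t` by the energy identity.
  have hzero : ∀ k, modeEigenvalue k ≠ t → inner ℝ w (cosMode k) = 0 := fun k hk =>
    (isWeakGrad_nodalSum hDm hP hD _).inner_cosMode_eq_zero
      (energy_nodalSum hDm hP hD hdisj hPt _).le (fun k hk => by
        by_cases hkS : k ∈ S
        · exact hak k ⟨hkS, hk⟩
        · exact hS a k hkS) hk
  obtain ⟨c, hc⟩ := exists_eq_trigPoly (u := w) (finite_modeEigenvalue_le t).toFinset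
    (fun k hk => hzero k fun h => hk (by simp [h]))
  set Q := trigPoly (finite_modeEigenvalue_le t).toFinset c with hQ
  have hQa : AnalyticOnNhd ℝ Q univ := analyticOnNhd_trigPoly _ _
  have hQP : Q =ᵐ[squareMeasure] fun z => ∑ i, a (ℓ i) * (D i).indicator P z :=
    hc.symm.trans (coeFn_nodalSum hDm hP.continuous _)
  have hsub : ∀ i, D i ⊆ square := fun i z hz => (nodalDomain_subset (hD i) hz).1
  have hopen : ∀ i, IsOpen (D i) := fun i => isOpen_nodalDomain hP.continuous (hD i)
  obtain ⟨j, hj⟩ := hℓ q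
  have hQ0 : Q = 0 := by
    refine eq_zero_of_analyticOnNhd_of_eqOn_open hQa (hopen j) (nodalDomain_nonempty (hD j))
      (eqOn_zero_of_ae (contDiff_of_analyticOnNhd hQa).continuous (hopen j) (hsub j) ?_)
    filter_upwards [hQP] with z hz hzj
    rw [hz, sum_mul_indicator_of_mem hdisj _ _ hzj, hj, haq, zero_mul]
  -- A label with nonzero coefficient now forces `P` to vanish on one of its own nodal domains.
  obtain ⟨p, hp⟩ := Function.ne_iff.1 ha0
  obtain ⟨i, rfl⟩ := hℓ p
  obtain ⟨z, hz⟩ := nodalDomain_nonempty (hD i)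
  refine (nodalDomain_subset (hD i) hz).2 (eqOn_zero_of_ae hP.continuous (hopen i) (hsub i) ?_ z hz)
  filter_upwards [hQP] with z hz hzi
  rw [hQ0, Pi.zero_apply, sum_mul_indicator_of_mem hdisj _ _ hzi] at hz
  exact (mul_eq_zero.1 hz.symm).resolve_left hp

/-! ### Counting modes below an eigenvalue; the form of eigenfunctions -/

lemma linearIndependent_cosMode : LinearIndependent ℝ cosMode :=
  linearIndependent_of_ne_zero_of_inner_eq_zero cosMode_ne_zero fun _ _ h => inner_cosMode_of_ne h

/-- Fewer than `m` modes of a symmetry class lie strictly below its `m`-th eigenvalue. -/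
lemma ncard_modes_lt {H : Set (ℝ × ℝ → ℝ)} {S : Set (ℕ × ℕ)}
    (hS : ∀ k ∈ S, (cosMode k : ℝ × ℝ → ℝ) ∈ H) {m : ℕ} (hm : 1 ≤ m) :
    {k ∈ S | modeEigenvalue k < eigenvalueOn H m}.ncard < m := by
  set t := eigenvalueOn H m with ht
  have hfin : {k ∈ S | modeEigenvalue k < t}.Finite :=
    (finite_modeEigenvalue_le t).subset fun k hk => hk.2.le
  by_contra! hle
  obtain ⟨T, hT, hTm⟩ := exists_subset_card_eq hle
  have hTfin : T.Finite := hfin.subset hT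
  have hTne : T.Nonempty := by
    rw [nonempty_iff_ne_empty]
    rintro rfl
    rw [ncard_empty] at hTm
    omega
  -- If `m` modes lay below `t`, the largest of their eigenvalues would be an admissible competitor
  -- in the infimum defining `t`, yet strictly smaller than `t`.
  obtain ⟨k₀, hk₀, hmax⟩ := exists_max_image T modeEigenvalue hTfin hTne
  have := hTfin.fintype
  have e : Fin m ≃ T := (Fintype.equivFinOfCardEq (by
    rw [← Nat.card_eq_fintype_card, Nat.card_coe_set_eq, hTm])).symm
  have hle : t ≤ modeEigenvalue k₀ := by
    refine csInf_le ⟨0, ?_⟩ ⟨fun i => cosMode (e i), ?_, fun i => ⟨hS _ (hT (e i).2).1,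
      modeEigenvalue (e i), hmax _ (e i).2, isNeumannLaplacian_cosMode _⟩⟩
    · rintro s ⟨v, hv, h⟩
      obtain ⟨-, r, hr, hN⟩ := h ⟨0, hm⟩
      exact (hN.nonneg (hv.ne_zero _)).trans hr
    · exact linearIndependent_cosMode.comp (fun i => (e i : ℕ × ℕ))
        (Subtype.val_injective.comp e.injective)
  exact (hT hk₀).2.not_ge hle

/-- An eigenfunction is a combination of modes with the same eigenvalue. -/
lemma IsEigenpair.exists_trigPoly {t : ℝ} {Ψ : ℝ × ℝ → ℝ} (h : IsEigenpair t Ψ) :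
    ∃ s c, (∀ k ∈ s, modeEigenvalue k = t) ∧ EqOn Ψ (trigPoly s c) square ∧
      ∀ hc : Continuous (trigPoly s c),
        IsNeumannLaplacian (ofContinuous (trigPoly s c) hc) (t • ofContinuous (trigPoly s c) hc) := by
  obtain ⟨hΨ, u, -, hΨu, hu⟩ := h
  have hfin : {k | modeEigenvalue k = t}.Finite :=
    (finite_modeEigenvalue_le t).subset fun k hk => le_of_eq hk
  obtain ⟨c, hc⟩ := exists_eq_trigPoly (u := u) hfin.toFinset (fun k hk =>
    hu.inner_eq_zero (isNeumannLaplacian_cosMode k) fun h => hk (by simp [h]))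
  have hcont : Continuous (trigPoly hfin.toFinset c) :=
    (contDiff_of_analyticOnNhd (analyticOnNhd_trigPoly _ _)).continuous
  refine ⟨hfin.toFinset, c, fun k hk => by simpa using hk,
    eqOn_of_ae_eq_square (hΨu.trans hc) hΨ hcont.continuousOn, fun hc' => ?_⟩
  have : ofContinuous (trigPoly hfin.toFinset c) hc' = u :=
    Lp.ext ((coeFn_ofContinuous hc').trans hc.symm)
  rwa [this]

lemma nodalDomains_congr {Ψ P : ℝ × ℝ → ℝ} (h : EqOn Ψ P square) :
    nodalDomains Ψ = nodalDomains P := by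
  have : {z ∈ square | Ψ z ≠ 0} = {z ∈ square | P z ≠ 0} := by
    ext z
    exact and_congr_right fun hz => by rw [h hz]
  rw [nodalDomains, nodalDomains, this]

/-! ### Symmetries of the square and their action on modes and nodal domains -/

/-- Measure preserving involutions of the plane that preserve the square. -/
structure IsSquareSymm (σ : ℝ × ℝ ≃ₜ ℝ × ℝ) : Prop where
  apply_apply : ∀ z, σ (σ z) = z
  mem_iff : ∀ z, σ z ∈ square ↔ z ∈ square
  measurePreserving_volume : MeasurePreserving σ volume volume

lemma IsSquareSymm.measurePreserving {σ : ℝ × ℝ ≃ₜ ℝ × ℝ} (hσ : IsSquareSymm σ) :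
    MeasurePreserving σ squareMeasure squareMeasure := by
  have h : σ ⁻¹' square = square := by ext z; exact hσ.mem_iff z
  have := hσ.measurePreserving_volume.restrict_preimage measurableSet_square
  rwa [h] at this

lemma sub_mem_Ioo_iff (x : ℝ) : Real.pi - x ∈ Ioo 0 Real.pi ↔ x ∈ Ioo 0 Real.pi := by
  simp only [mem_Ioo]
  constructor <;> rintro ⟨h1, h2⟩ <;> constructor <;> linarith

/-- The reflection `(x, y) ↦ (π - x, y)`. -/
def mirrorX : ℝ × ℝ ≃ₜ ℝ × ℝ := (Homeomorph.subLeft Real.pi).prodCongr (Homeomorph.refl ℝ)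

/-- The reflection `(x, y) ↦ (x, π - y)`. -/
def mirrorY : ℝ × ℝ ≃ₜ ℝ × ℝ := (Homeomorph.refl ℝ).prodCongr (Homeomorph.subLeft Real.pi)

/-- The rotation `(x, y) ↦ (π - x, π - y)`. -/
def rotation : ℝ × ℝ ≃ₜ ℝ × ℝ :=
  (Homeomorph.subLeft Real.pi).prodCongr (Homeomorph.subLeft Real.pi)

lemma mirrorX_apply (z : ℝ × ℝ) : mirrorX z = (Real.pi - z.1, z.2) := rfl

lemma mirrorY_apply (z : ℝ × ℝ) : mirrorY z = (z.1, Real.pi - z.2) := rfl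

lemma rotation_apply (z : ℝ × ℝ) : rotation z = (Real.pi - z.1, Real.pi - z.2) := rfl

lemma isSquareSymm_mirrorX : IsSquareSymm mirrorX where
  apply_apply z := by simp [mirrorX_apply]
  mem_iff z := and_congr (sub_mem_Ioo_iff z.1) Iff.rfl
  measurePreserving_volume :=
    (Measure.measurePreserving_sub_left volume Real.pi).prod (MeasurePreserving.id volume)

lemma isSquareSymm_mirrorY : IsSquareSymm mirrorY where
  apply_apply z := by simp [mirrorY_apply]
  mem_iff z := and_congr Iff.rfl (sub_mem_Ioo_iff z.2)
  measurePreserving_volume :=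
    (MeasurePreserving.id volume).prod (Measure.measurePreserving_sub_left volume Real.pi)

lemma isSquareSymm_rotation : IsSquareSymm rotation where
  apply_apply z := by simp [rotation_apply]
  mem_iff z := and_congr (sub_mem_Ioo_iff z.1) (sub_mem_Ioo_iff z.2)
  measurePreserving_volume :=
    (Measure.measurePreserving_sub_left volume Real.pi).prod
      (Measure.measurePreserving_sub_left volume Real.pi)

lemma cosFun_mirrorX (k : ℕ × ℕ) (z : ℝ × ℝ) :
    cosFun k (mirrorX z) = (-1) ^ k.1 * cosFun k z := by
  simp only [cosFun, mirrorX_apply, mul_sub, Real.cos_nat_mul_pi_sub]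
  ring

lemma cosFun_mirrorY (k : ℕ × ℕ) (z : ℝ × ℝ) :
    cosFun k (mirrorY z) = (-1) ^ k.2 * cosFun k z := by
  simp only [cosFun, mirrorY_apply, mul_sub, Real.cos_nat_mul_pi_sub]
  ring

lemma cosFun_rotation (k : ℕ × ℕ) (z : ℝ × ℝ) :
    cosFun k (rotation z) = (-1) ^ (k.1 + k.2) * cosFun k z := by
  simp only [cosFun, rotation_apply, mul_sub, Real.cos_nat_mul_pi_sub, pow_add]
  ring

section Symm

variable {σ : ℝ × ℝ ≃ₜ ℝ × ℝ}

lemma IsSquareSymm.cosMode_comp (hσ : IsSquareSymm σ) {k : ℕ × ℕ} {δ : ℝ}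
    (h : ∀ z, cosFun k (σ z) = δ * cosFun k z) :
    ∀ᵐ z ∂squareMeasure, cosMode k (σ z) = δ * cosMode k z := by
  have h1 := coeFn_ofContinuous (continuous_cosFun k)
  filter_upwards [h1, hσ.measurePreserving.quasiMeasurePreserving.tendsto_ae.eventually h1]
    with z h2 h3
  rw [cosMode, h2, h3, h]

/-- Functions of different parity are orthogonal. -/
lemma IsSquareSymm.inner_cosMode_eq_zero (hσ : IsSquareSymm σ) {u : L2} {k : ℕ × ℕ} {ε δ : ℝ}
    (hu : ∀ᵐ z ∂squareMeasure, u (σ z) = ε * u z)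
    (hk : ∀ z, cosFun k (σ z) = δ * cosFun k z) (h : ε * δ ≠ 1) :
    inner ℝ u (cosMode k) = 0 := by
  -- The change of variables by `σ` preserves the integral but multiplies the integrand by `ε * δ`.
  have h1 : inner ℝ u (cosMode k) = ε * δ * inner ℝ u (cosMode k) := by
    rw [cosMode, inner_ofContinuous_right]
    conv_lhs => rw [← hσ.measurePreserving.integral_comp σ.measurableEmbedding]
    rw [← integral_const_mul]
    refine integral_congr_ae ?_
    filter_upwards [hu] with z hz
    rw [hz, hk]
    ring
  have h2 : (1 - ε * δ) * inner ℝ u (cosMode k) = 0 := by linarith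
  exact (mul_eq_zero.1 h2).resolve_left (sub_ne_zero.2 h.symm)

variable {P : ℝ × ℝ → ℝ} {ε : ℝ}

lemma IsSquareSymm.image_nonzeroSet (hσ : IsSquareSymm σ)
    (hP : ∀ z ∈ square, P (σ z) = ε * P z) :
    σ '' {z ∈ square | P z ≠ 0} = {z ∈ square | P z ≠ 0} := by
  have h : ∀ z ∈ {z ∈ square | P z ≠ 0}, σ z ∈ {z ∈ square | P z ≠ 0} := by
    rintro z ⟨hz, hz0⟩
    refine ⟨(hσ.mem_iff z).2 hz, fun h0 => hz0 ?_⟩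
    have := hP (σ z) ((hσ.mem_iff z).2 hz)
    rwa [hσ.apply_apply, h0, mul_zero] at this
  refine Subset.antisymm (image_subset_iff.2 h) fun z hz => ⟨σ z, h z hz, hσ.apply_apply z⟩

lemma IsSquareSymm.image_mem_nodalDomains (hσ : IsSquareSymm σ)
    (hP : ∀ z ∈ square, P (σ z) = ε * P z) {D : Set (ℝ × ℝ)} (hD : D ∈ nodalDomains P) :
    σ '' D ∈ nodalDomains P := by
  obtain ⟨x, hx, rfl⟩ := hD
  rw [σ.image_connectedComponentIn hx, hσ.image_nonzeroSet hP]
  refine ⟨σ x, ?_, rfl⟩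
  rw [← hσ.image_nonzeroSet hP]
  exact mem_image_of_mem σ hx

/-- The symmetry sends each nodal domain to another with the same coefficient, so the sum inherits
the parity `ε` of `P`. -/
lemma IsSquareSymm.nodalSum_comp (hσ : IsSquareSymm σ) (hP : ∀ z ∈ square, P (σ z) = ε * P z)
    (hPc : Continuous P) [Fintype (nodalDomains P)]
    (hDm : ∀ D : nodalDomains P, MeasurableSet (D : Set (ℝ × ℝ))) (β : Set (ℝ × ℝ) → ℝ)
    (hβ : ∀ D ∈ nodalDomains P, β (σ '' D) = β D) :
    ∀ᵐ z ∂squareMeasure, nodalSum P hPc hDm (fun D => β D) (σ z) =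
      ε * nodalSum P hPc hDm (fun D => β D) z := by
  have hdisj : Pairwise fun i j : nodalDomains P => Disjoint (i : Set (ℝ × ℝ)) j := fun i j hij =>
    disjoint_left.2 fun z hz hz' => hij (Subtype.ext (nodalDomain_eq_of_mem i.2 j.2 hz hz'))
  have h1 := coeFn_nodalSum hDm hPc fun D => β D
  filter_upwards [h1, hσ.measurePreserving.quasiMeasurePreserving.tendsto_ae.eventually h1,
    ae_restrict_mem measurableSet_square] with z h2 h3 hz
  rw [h2, h3]
  by_cases h0 : P z = 0
  · have h0' : P (σ z) = 0 := by rw [hP z hz, h0, mul_zero]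
    have e : ∀ (E : Set (ℝ × ℝ)) (w : ℝ × ℝ), P w = 0 → E.indicator P w = 0 := fun E w hw => by
      rw [indicator_apply_eq_zero]; exact fun _ => hw
    simp only [e _ _ h0, e _ _ h0', mul_zero, Finset.sum_const_zero]
  · have hx : z ∈ {z ∈ square | P z ≠ 0} := ⟨hz, h0⟩
    have hj : connectedComponentIn {z ∈ square | P z ≠ 0} z ∈ nodalDomains P := ⟨z, hx, rfl⟩
    have hj' := hσ.image_mem_nodalDomains hP hj
    have hz1 := mem_connectedComponentIn hx
    rw [sum_mul_indicator_of_mem hdisj P (fun D : nodalDomains P => β D) (j := ⟨_, hj⟩) hz1,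
      sum_mul_indicator_of_mem hdisj P (fun D : nodalDomains P => β D) (j := ⟨_, hj'⟩)
        (mem_image_of_mem σ hz1), hP z hz, hβ _ hj]
    ring

end Symm

/-! ### Finiteness, and Courant's bound for orbits -/

section Count

variable {P : ℝ × ℝ → ℝ} {t : ℝ}

/-- Courant's bound without symmetry: every domain is its own label and all modes are allowed. An
infinite family would contain one more domain than the bound permits. -/
lemma finite_nodalDomains (hP : ContDiff ℝ ∞ P)
    (hPt : IsNeumannLaplacian (ofContinuous P hP.continuous) (t • ofContinuous P hP.continuous)) :
    (nodalDomains P).Finite := by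
  by_contra hinf
  obtain ⟨T, hT, hcard⟩ := Set.Infinite.exists_subset_card_eq hinf
    ({k ∈ (univ : Set (ℕ × ℕ)) | modeEigenvalue k < t}.ncard + 2)
  have h := card_label_le hP hPt (ι := T) (D := fun D => D) (fun D => hT D.2)
    Subtype.val_injective (fun D => (isOpen_nodalDomain hP.continuous (hT D.2)).measurableSet)
    id Function.surjective_id univ (fun a k hk => absurd trivial hk)
  rw [Fintype.card_coe, hcard] at h
  omega

open Classical in
/-- Courant's bound for the orbits of a group of symmetries, `L` being a complete invariant of
the orbits. -/
lemma card_orbits_le (hP : ContDiff ℝ ∞ P)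
    (hPt : IsNeumannLaplacian (ofContinuous P hP.continuous) (t • ofContinuous P hP.continuous))
    (hfin : (nodalDomains P).Finite) (L : Set (ℝ × ℝ) → Set (ℝ × ℝ)) (S : Set (ℕ × ℕ))
    (hS : ∀ k ∉ S, ∃ (σ : ℝ × ℝ ≃ₜ ℝ × ℝ) (ε δ : ℝ), IsSquareSymm σ ∧
      (∀ z ∈ square, P (σ z) = ε * P z) ∧ (∀ D, L (σ '' D) = L D) ∧
      (∀ z, cosFun k (σ z) = δ * cosFun k z) ∧ ε * δ ≠ 1) :
    (hfin.toFinset.image L).card ≤ {k ∈ S | modeEigenvalue k < t}.ncard + 1 := by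
  have := hfin.fintype
  have hmem : ∀ D : nodalDomains P, L D ∈ hfin.toFinset.image L := fun D =>
    Finset.mem_image_of_mem L (hfin.mem_toFinset.2 D.2)
  have hDm : ∀ D : nodalDomains P, MeasurableSet (D : Set (ℝ × ℝ)) := fun D =>
    (isOpen_nodalDomain hP.continuous D.2).measurableSet
  have h := card_label_le hP hPt (D := fun D : nodalDomains P => (D : Set (ℝ × ℝ)))
    (fun D => D.2) Subtype.val_injective hDm (κ := hfin.toFinset.image L)
    (fun D => ⟨L D, hmem D⟩) ?_ S ?_
  · rwa [Fintype.card_coe] at h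
  · rintro ⟨_, hq⟩
    obtain ⟨D, hD, rfl⟩ := Finset.mem_image.1 hq
    exact ⟨⟨D, hfin.mem_toFinset.1 hD⟩, rfl⟩
  · intro a k hk
    obtain ⟨σ, ε, δ, hσ, hPσ, hL, hkσ, hne⟩ := hS k hk
    -- The coefficient must be a function of arbitrary sets to be compared along `σ`; the default 0
    -- is never taken on a nodal domain.
    let β : Set (ℝ × ℝ) → ℝ := fun D =>
      if h : L D ∈ hfin.toFinset.image L then a ⟨L D, h⟩ else 0
    have hβ : (fun D : nodalDomains P => a ⟨L D, hmem D⟩) = fun D : nodalDomains P => β D := by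
      funext D
      simp only [β, dif_pos (hmem D)]
    rw [hβ]
    exact hσ.inner_cosMode_eq_zero (hσ.nodalSum_comp hPσ hP.continuous hDm β fun D _ => by
      simp only [β, hL]) hkσ hne

end Count

/-! ### Orbits of nodal domains and their sizes -/

lemma IsSquareSymm.image_image {σ : ℝ × ℝ ≃ₜ ℝ × ℝ} (hσ : IsSquareSymm σ) (D : Set (ℝ × ℝ)) :
    σ '' (σ '' D) = D := by
  rw [Set.image_image]
  simp [hσ.apply_apply]

/-- `P` has a constant sign on a nodal domain, and `σ` reverses that sign. -/
lemma image_nodalDomain_ne {σ : ℝ × ℝ ≃ₜ ℝ × ℝ} {P : ℝ × ℝ → ℝ}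
    (hP : Continuous P) (hPσ : ∀ z ∈ square, P (σ z) = -1 * P z) {D : Set (ℝ × ℝ)}
    (hD : D ∈ nodalDomains P) : σ '' D ≠ D := by
  intro h
  obtain ⟨x, hx⟩ := nodalDomain_nonempty hD
  have hx' : σ x ∈ D := h ▸ mem_image_of_mem σ hx
  have e := hPσ x (nodalDomain_subset hD hx).1
  rcases nodalDomain_sign hP hD with h | h
  · linarith [h x hx, h _ hx']
  · linarith [h x hx, h _ hx']

lemma mirrorX_image_mirrorY (D : Set (ℝ × ℝ)) : mirrorX '' (mirrorY '' D) = rotation '' D := by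
  rw [Set.image_image]; rfl

lemma mirrorY_image_mirrorX (D : Set (ℝ × ℝ)) : mirrorY '' (mirrorX '' D) = rotation '' D := by
  rw [Set.image_image]; rfl

lemma mirrorX_image_rotation (D : Set (ℝ × ℝ)) : mirrorX '' (rotation '' D) = mirrorY '' D := by
  rw [← mirrorX_image_mirrorY, isSquareSymm_mirrorX.image_image]

lemma mirrorY_image_rotation (D : Set (ℝ × ℝ)) : mirrorY '' (rotation '' D) = mirrorX '' D := by
  rw [← mirrorY_image_mirrorX, isSquareSymm_mirrorY.image_image]

/-- If `P` is odd in the first variable, no nodal domain is invariant under the rotation. -/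
lemma rotation_image_ne {P : ℝ × ℝ → ℝ} (hPX : ∀ z ∈ square, P (mirrorX z) = -1 * P z)
    {D : Set (ℝ × ℝ)} (hD : D ∈ nodalDomains P) : rotation '' D ≠ D := by
  intro h
  obtain ⟨x, hx⟩ := nodalDomain_nonempty hD
  have hx' : rotation x ∈ D := h ▸ mem_image_of_mem rotation hx
  have hconn := isPreconnected_nodalDomain hD
  -- The first coordinates of `x` and its image lie symmetrically about `π / 2`, so connectedness
  -- gives a point of `D` on the mirror axis, where oddness forces `P = 0`.
  obtain ⟨w, hw, hw1⟩ : ∃ w ∈ D, w.1 = Real.pi / 2 := by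
    rcases le_total x.1 (Real.pi / 2) with hle | hle
    · exact hconn.intermediate_value hx hx' continuous_fst.continuousOn
        ⟨hle, by simp only [rotation_apply]; linarith⟩
    · exact hconn.intermediate_value hx' hx continuous_fst.continuousOn
        ⟨by simp only [rotation_apply]; linarith, hle⟩
  have hw' := nodalDomain_subset hD hw
  have hfix : mirrorX w = w := by
    rw [mirrorX_apply]
    exact Prod.ext (by simp only; linarith) rfl
  have e := hPX w hw'.1
  rw [hfix] at e
  exact hw'.2 (by linarith)

/-- The orbit of a set under the rotation. -/
def rotationOrbit (D : Set (ℝ × ℝ)) : Set (ℝ × ℝ) := D ∪ rotation '' D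

lemma rotationOrbit_image (D : Set (ℝ × ℝ)) : rotationOrbit (rotation '' D) = rotationOrbit D := by
  rw [rotationOrbit, rotationOrbit, isSquareSymm_rotation.image_image, union_comm]

/-- The orbit of a set under the reflections. -/
def mirrorOrbit (D : Set (ℝ × ℝ)) : Set (ℝ × ℝ) :=
  (D ∪ mirrorX '' D) ∪ (mirrorY '' D ∪ rotation '' D)

lemma mirrorOrbit_mirrorX (D : Set (ℝ × ℝ)) : mirrorOrbit (mirrorX '' D) = mirrorOrbit D := by
  have h : rotation '' (mirrorX '' D) = mirrorY '' D := by
    rw [← mirrorY_image_mirrorX, isSquareSymm_mirrorX.image_image]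
  rw [mirrorOrbit, mirrorOrbit, isSquareSymm_mirrorX.image_image, mirrorY_image_mirrorX, h,
    union_comm D, union_comm (mirrorY '' D)]

lemma mirrorOrbit_mirrorY (D : Set (ℝ × ℝ)) : mirrorOrbit (mirrorY '' D) = mirrorOrbit D := by
  have h : rotation '' (mirrorY '' D) = mirrorX '' D := by
    rw [← mirrorX_image_mirrorY, isSquareSymm_mirrorY.image_image]
  rw [mirrorOrbit, mirrorOrbit, isSquareSymm_mirrorY.image_image, mirrorX_image_mirrorY, h,
    union_comm, union_comm D, union_comm (mirrorY '' D)]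

lemma mirrorOrbit_rotation (D : Set (ℝ × ℝ)) : mirrorOrbit (rotation '' D) = mirrorOrbit D := by
  rw [← mirrorX_image_mirrorY, mirrorOrbit_mirrorX, mirrorOrbit_mirrorY]

section Count

variable {P : ℝ × ℝ → ℝ} {t : ℝ}

open Classical in
-- The union of an orbit determines the orbit: a domain inside it shares a point with one of its
-- members, hence equals that member.
lemma filter_rotationOrbit_eq (hfin : (nodalDomains P).Finite) {ε : ℝ}
    (hP : ∀ z ∈ square, P (rotation z) = ε * P z) {D : Set (ℝ × ℝ)} (hD : D ∈ nodalDomains P) :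
    {E ∈ hfin.toFinset | rotationOrbit E = rotationOrbit D} = {D, rotation '' D} := by
  have hD' := isSquareSymm_rotation.image_mem_nodalDomains hP hD
  ext E
  simp only [Finset.mem_filter, hfin.mem_toFinset, Finset.mem_insert, Finset.mem_singleton]
  constructor
  · rintro ⟨hE, h⟩
    obtain ⟨x, hx⟩ := nodalDomain_nonempty hE
    have hx' : x ∈ rotationOrbit D := h ▸ Or.inl hx
    rcases hx' with hx' | hx'
    · exact Or.inl (nodalDomain_eq_of_mem hE hD hx hx')
    · exact Or.inr (nodalDomain_eq_of_mem hE hD' hx hx')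
  · rintro (rfl | rfl)
    · exact ⟨hD, rfl⟩
    · exact ⟨hD', rotationOrbit_image D⟩

open Classical in
lemma filter_mirrorOrbit_eq (hfin : (nodalDomains P).Finite) {ε₁ ε₂ : ℝ}
    (hX : ∀ z ∈ square, P (mirrorX z) = ε₁ * P z) (hY : ∀ z ∈ square, P (mirrorY z) = ε₂ * P z)
    {D : Set (ℝ × ℝ)} (hD : D ∈ nodalDomains P) :
    {E ∈ hfin.toFinset | mirrorOrbit E = mirrorOrbit D} =
      {D, mirrorX '' D, mirrorY '' D, rotation '' D} := by
  have hDX := isSquareSymm_mirrorX.image_mem_nodalDomains hX hD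
  have hDY := isSquareSymm_mirrorY.image_mem_nodalDomains hY hD
  have hDR := isSquareSymm_mirrorX.image_mem_nodalDomains hX hDY
  rw [mirrorX_image_mirrorY] at hDR
  ext E
  simp only [Finset.mem_filter, hfin.mem_toFinset, Finset.mem_insert, Finset.mem_singleton]
  constructor
  · rintro ⟨hE, h⟩
    obtain ⟨x, hx⟩ := nodalDomain_nonempty hE
    have hx' : x ∈ mirrorOrbit D := h ▸ Or.inl (Or.inl hx)
    rcases hx' with (hx' | hx') | (hx' | hx')
    · exact Or.inl (nodalDomain_eq_of_mem hE hD hx hx')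
    · exact Or.inr (Or.inl (nodalDomain_eq_of_mem hE hDX hx hx'))
    · exact Or.inr (Or.inr (Or.inl (nodalDomain_eq_of_mem hE hDY hx hx')))
    · exact Or.inr (Or.inr (Or.inr (nodalDomain_eq_of_mem hE hDR hx hx')))
  · rintro (rfl | rfl | rfl | rfl)
    · exact ⟨hD, rfl⟩
    · exact ⟨hDX, mirrorOrbit_mirrorX D⟩
    · exact ⟨hDY, mirrorOrbit_mirrorY D⟩
    · exact ⟨hDR, mirrorOrbit_rotation D⟩

lemma card_eq_mul_card_image {α β : Type*} [DecidableEq β] (s : Finset α) (f : α → β) (n : ℕ)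
    (h : ∀ a ∈ s, {b ∈ s | f b = f a}.card = n) : s.card = n * (s.image f).card := by
  rw [Finset.card_eq_sum_card_image f s, Finset.sum_const_nat (m := n), mul_comm]
  intro b hb
  obtain ⟨a, ha, rfl⟩ := Finset.mem_image.1 hb
  exact h a ha

open Classical in
lemma nodalCount_eq_two_mul (hfin : (nodalDomains P).Finite) (hPc : Continuous P)
    (hP : ∀ z ∈ square, P (rotation z) = -1 * P z) :
    nodalCount P = 2 * (hfin.toFinset.image rotationOrbit).card := by
  rw [nodalCount, ncard_eq_toFinset_card _ hfin]
  refine card_eq_mul_card_image _ _ _ fun D hD => ?_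
  rw [hfin.mem_toFinset] at hD
  rw [filter_rotationOrbit_eq hfin hP hD]
  exact Finset.card_pair (image_nodalDomain_ne hPc hP hD).symm

open Classical in
lemma nodalCount_le_two_mul (hfin : (nodalDomains P).Finite) {ε : ℝ}
    (hP : ∀ z ∈ square, P (rotation z) = ε * P z) :
    nodalCount P ≤ 2 * (hfin.toFinset.image rotationOrbit).card := by
  rw [nodalCount, ncard_eq_toFinset_card _ hfin]
  refine Finset.card_le_mul_card_image _ _ fun b hb => ?_
  obtain ⟨D, hD, rfl⟩ := Finset.mem_image.1 hb
  rw [hfin.mem_toFinset] at hD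
  rw [filter_rotationOrbit_eq hfin hP hD]
  exact Finset.card_le_two

open Classical in
-- The group generated by the mirrors acts freely: each mirror reverses the sign, and the half-turn
-- is excluded by `rotation_image_ne`. A coincidence between two images would give one of these
-- three a fixed domain.
lemma nodalCount_eq_four_mul (hfin : (nodalDomains P).Finite) (hPc : Continuous P)
    (hX : ∀ z ∈ square, P (mirrorX z) = -1 * P z) (hY : ∀ z ∈ square, P (mirrorY z) = -1 * P z) :
    nodalCount P = 4 * (hfin.toFinset.image mirrorOrbit).card := by
  rw [nodalCount, ncard_eq_toFinset_card _ hfin]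
  refine card_eq_mul_card_image _ _ _ fun D hD => ?_
  rw [hfin.mem_toFinset] at hD
  rw [filter_mirrorOrbit_eq hfin hX hY hD]
  have nX := image_nodalDomain_ne hPc hX hD
  have nY := image_nodalDomain_ne hPc hY hD
  have nR := rotation_image_ne hX hD
  have nXY : mirrorX '' D ≠ mirrorY '' D := fun h => nR (by
    rw [← mirrorX_image_mirrorY, ← h, isSquareSymm_mirrorX.image_image])
  have nXR : mirrorX '' D ≠ rotation '' D := fun h => nY (by
    rw [← mirrorX_image_rotation, ← h, isSquareSymm_mirrorX.image_image])
  have nYR : mirrorY '' D ≠ rotation '' D := fun h => nX (by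
    rw [← mirrorY_image_rotation, ← h, isSquareSymm_mirrorY.image_image])
  rw [Finset.card_insert_of_notMem, Finset.card_insert_of_notMem, Finset.card_pair nYR]
  · simp [nXY, nXR]
  · simp [nX.symm, nY.symm, nR.symm]

end Count

/-! ### Parity of modes, and the final count -/

lemma cosMode_mem_ARot {k : ℕ × ℕ} (hk : Odd (k.1 + k.2)) :
    (cosMode k : ℝ × ℝ → ℝ) ∈ ARot := by
  have := isSquareSymm_rotation.cosMode_comp (cosFun_rotation k)
  simp only [hk.neg_one_pow, neg_one_mul] at this
  exact this

lemma cosMode_mem_SRot {k : ℕ × ℕ} (hk : Even (k.1 + k.2)) :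
    (cosMode k : ℝ × ℝ → ℝ) ∈ SRot := by
  have := isSquareSymm_rotation.cosMode_comp (cosFun_rotation k)
  simp only [hk.neg_one_pow, one_mul] at this
  exact this

lemma cosMode_mem_AMir {k : ℕ × ℕ} (hk : Odd k.1 ∧ Odd k.2) :
    (cosMode k : ℝ × ℝ → ℝ) ∈ AMir := by
  have h1 := isSquareSymm_mirrorX.cosMode_comp (cosFun_mirrorX k)
  have h2 := isSquareSymm_mirrorY.cosMode_comp (cosFun_mirrorY k)
  simp only [hk.1.neg_one_pow, hk.2.neg_one_pow, neg_one_mul] at h1 h2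
  exact h1.and h2

lemma modeEigenvalue_eq_intCast {k : ℕ × ℕ} {j : ℤ} (h : modeEigenvalue k = j) :
    ((k.1 : ℤ) ^ 2 + (k.2 : ℤ) ^ 2) = j := by
  rw [modeEigenvalue] at h
  exact_mod_cast h

lemma odd_add_of_modeEigenvalue {k : ℕ × ℕ} {j : ℤ} (h : modeEigenvalue k = j) (hj : Odd j) :
    Odd (k.1 + k.2) := by
  rw [← modeEigenvalue_eq_intCast h] at hj
  have : Odd ((k.1 + k.2 : ℕ) : ℤ) := by
    push_cast
    simpa [Int.odd_add, Int.even_pow, Int.odd_pow] using hj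
  exact_mod_cast this

lemma even_add_of_modeEigenvalue {k : ℕ × ℕ} {j : ℤ} (h : modeEigenvalue k = j) (hj : Even j) :
    Even (k.1 + k.2) := by
  rw [← modeEigenvalue_eq_intCast h] at hj
  have : Even ((k.1 + k.2 : ℕ) : ℤ) := by
    push_cast
    simpa [Int.even_add, Int.even_pow] using hj
  exact_mod_cast this

lemma trigPoly_comp {s : Finset (ℕ × ℕ)} {c : ℕ × ℕ → ℝ} {σ : ℝ × ℝ ≃ₜ ℝ × ℝ} {ε : ℝ}
    (h : ∀ k ∈ s, ∀ z, cosFun k (σ z) = ε * cosFun k z) (z : ℝ × ℝ) :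
    trigPoly s c (σ z) = ε * trigPoly s c z := by
  rw [trigPoly, trigPoly, Finset.mul_sum]
  exact Finset.sum_congr rfl fun k hk => by rw [h k hk]; ring

lemma IsSquareSymm.comp_eq_of_ae {σ : ℝ × ℝ ≃ₜ ℝ × ℝ} (hσ : IsSquareSymm σ) {Ψ P : ℝ × ℝ → ℝ}
    (hP : Continuous P) (hΨP : EqOn Ψ P square)
    (h : ∀ᵐ z ∂squareMeasure, Ψ (σ z) = -Ψ z) : ∀ z ∈ square, P (σ z) = -1 * P z := by
  refine eqOn_of_ae_eq_square ?_ (hP.comp σ.continuous).continuousOn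
    (continuous_const.mul hP).continuousOn
  filter_upwards [h, ae_restrict_mem measurableSet_square] with z hz hzs
  rw [← hΨP ((hσ.mem_iff z).2 hzs), ← hΨP hzs, hz, neg_one_mul]

end NeumannSquare

end

open NeumannSquare in
theorem mainTheorem3 (n : ℕ) (hn : 1 ≤ n) (Ψ : ℝ × ℝ → ℝ)
    (hΨ : NeumannSquare.IsEigenpair (NeumannSquare.eigenvalue n) Ψ) :
    (NeumannSquare.nodalDomains Ψ).Finite ∧
    -- odd eigenvalues
    ((∃ k : ℤ, Odd k ∧ NeumannSquare.eigenvalue n = k) →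
      Even (NeumannSquare.nodalCount Ψ) ∧
      ∀ m : ℕ, 1 ≤ m →
        NeumannSquare.eigenvalue n = NeumannSquare.eigenvalueOn NeumannSquare.ARot m →
        NeumannSquare.nodalCount Ψ ≤ 2 * m) ∧
    -- even eigenvalues
    ((∃ k : ℤ, Even k ∧ NeumannSquare.eigenvalue n = k) →
      ∀ m : ℕ, 1 ≤ m →
        NeumannSquare.eigenvalue n = NeumannSquare.eigenvalueOn NeumannSquare.SRot m →
        NeumannSquare.nodalCount Ψ ≤ 2 * m) ∧
    -- even eigenvalues, eigenfunctions antisymmetric under both reflections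
    ((∃ k : ℤ, Even k ∧ NeumannSquare.eigenvalue n = k) → Ψ ∈ NeumannSquare.AMir →
      4 ∣ NeumannSquare.nodalCount Ψ ∧
      ∀ m : ℕ, 1 ≤ m →
        NeumannSquare.eigenvalue n = NeumannSquare.eigenvalueOn NeumannSquare.AMir m →
        NeumannSquare.nodalCount Ψ ≤ 4 * m) := by
  classical
  obtain ⟨s, c, hs, hΨP, hN⟩ := hΨ.exists_trigPoly
  set P := trigPoly s c with hPdef
  have hP : ContDiff ℝ ∞ P := contDiff_of_analyticOnNhd (analyticOnNhd_trigPoly s c)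
  have hPt := hN hP.continuous
  have hfin := finite_nodalDomains hP hPt
  have hdom := nodalDomains_congr hΨP
  have hcount : nodalCount Ψ = nodalCount P := by rw [nodalCount, nodalCount, hdom]
  rw [hcount, hdom]
  refine ⟨hfin, ?_, ?_, ?_⟩
  · rintro ⟨j, hj, hnj⟩
    have hPR : ∀ z ∈ square, P (rotation z) = -1 * P z := fun z _ => trigPoly_comp
      (fun k hk z => by
        rw [cosFun_rotation,
          (odd_add_of_modeEigenvalue ((hs k hk).trans hnj) hj).neg_one_pow]) z
    have hc := nodalCount_eq_two_mul hfin hP.continuous hPR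
    refine ⟨hc ▸ even_two_mul _, fun m hm hnm => ?_⟩
    -- Modes outside the class are even under the half-turn while `P` is odd, so the product of the
    -- two signs is `-1`. With `h2`, the number of orbits is at most `N + 1 ≤ m`.
    have h1 := card_orbits_le hP hPt hfin rotationOrbit {k | Odd (k.1 + k.2)} fun k hk =>
      ⟨rotation, -1, _, isSquareSymm_rotation, hPR, rotationOrbit_image, cosFun_rotation k, by
        rw [(Nat.not_odd_iff_even.1 hk).neg_one_pow]; norm_num⟩
    have h2 := ncard_modes_lt (S := {k | Odd (k.1 + k.2)})
      (fun k hk => cosMode_mem_ARot hk) hm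
    rw [← hnm] at h2
    omega
  · rintro ⟨j, hj, hnj⟩ m hm hnm
    have hPR : ∀ z ∈ square, P (rotation z) = 1 * P z := fun z _ => trigPoly_comp
      (fun k hk z => by
        rw [cosFun_rotation,
          (even_add_of_modeEigenvalue ((hs k hk).trans hnj) hj).neg_one_pow]) z
    have hc := nodalCount_le_two_mul hfin hPR
    have h1 := card_orbits_le hP hPt hfin rotationOrbit {k | Even (k.1 + k.2)} fun k hk =>
      ⟨rotation, 1, _, isSquareSymm_rotation, hPR, rotationOrbit_image, cosFun_rotation k, by
        rw [(Nat.not_even_iff_odd.1 hk).neg_one_pow]; norm_num⟩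
    have h2 := ncard_modes_lt (S := {k | Even (k.1 + k.2)})
      (fun k hk => cosMode_mem_SRot hk) hm
    rw [← hnm] at h2
    omega
  · rintro - hmir
    have hX := isSquareSymm_mirrorX.comp_eq_of_ae hP.continuous hΨP
      (Filter.Eventually.mono hmir fun z hz => hz.1)
    have hY := isSquareSymm_mirrorY.comp_eq_of_ae hP.continuous hΨP
      (Filter.Eventually.mono hmir fun z hz => hz.2)
    have hc := nodalCount_eq_four_mul hfin hP.continuous hX hY
    refine ⟨⟨_, hc⟩, fun m hm hnm => ?_⟩
    -- A mode outside the class has an even index, so it is even under the corresponding mirror;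
    -- that mirror separates it from `P`.
    have h1 := card_orbits_le hP hPt hfin mirrorOrbit {k | Odd k.1 ∧ Odd k.2} fun k hk => by
      rcases not_and_or.1 hk with h | h
      · exact ⟨mirrorX, -1, _, isSquareSymm_mirrorX, hX, mirrorOrbit_mirrorX, cosFun_mirrorX k, by
          rw [(Nat.not_odd_iff_even.1 h).neg_one_pow]; norm_num⟩
      · exact ⟨mirrorY, -1, _, isSquareSymm_mirrorY, hY, mirrorOrbit_mirrorY, cosFun_mirrorY k, by
          rw [(Nat.not_odd_iff_even.1 h).neg_one_pow]; norm_num⟩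
    have h2 := ncard_modes_lt (S := {k | Odd k.1 ∧ Odd k.2})
      (fun k hk => cosMode_mem_AMir hk) hm
    rw [← hnm] at h2
    omega
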